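/- Let $\alpha,\beta,\gamma,\delta,\epsilon,q,t\in\mathbb{C}$ with $t\neq 0,1$ and $\gamma+\delta+\epsilon=\alpha+\beta+1$, and consider Heun's differential equation $$\frac{d^2y}{dz^2}+\left(\frac{\gamma}{z}+\frac{\delta}{z-1}+\frac{\epsilon}{z-t}\right)\frac{dy}{dz}+\frac{\alpha\beta z-q}{z(z-1)(z-t)}\,y=0 .$$ Assume that $\alpha\in\mathbb{Z}$, $\epsilon\in\mathbb{Z}$ and that the singularity $z=t$ (with exponents $0$ and $1-\epsilon$) is apparent, i.e. near $z=t$ there is a basis of solutions without logarithmic terms, of the form $u(z)$, $(z-t)^{1-\epsilon}v(z)$ with $u,v$ holomorphic at $t$ and $u(t)v(t)\neq 0$. Then the monodromy representation of the fundamental group $\pi_1(\mathbb{C}\setminus\{0,1,t\},b)$ (for any base point $b$) on the space of (multivalued) solutions of the equation, given by analytic continuation along loops, is reducible: there is an invariant linear subspace other than $\{0\}$ and the whole solution space. -/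

import Mathlib

noncomputable section

/-- The data of a Heun equation
`y'' + (γ/z + δ/(z-1) + ε/(z-t)) y' + (αβz - q)/(z(z-1)(z-t)) y = 0`
over `ℂ`: the finite singularities `0, 1, t` are distinct and the Fuchs relation holds. -/
structure HeunEquation where
  α : ℂ
  β : ℂ
  γ : ℂ
  δ : ℂ
  ε : ℂ
  q : ℂ
  t : ℂ
  t_ne_zero : t ≠ 0
  t_ne_one : t ≠ 1
  fuchs : γ + δ + ε = α + β + 1

namespace HeunEquation

variable (E : HeunEquation)

/-- The domain `ℂ \ {0, 1, t}` as a set. -/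
def domain : Set ℂ := {z | z ≠ 0 ∧ z ≠ 1 ∧ z ≠ E.t}

/-- `y` is a holomorphic solution of the Heun equation on `U ⊆ ℂ \ {0, 1, t}`
(used only for open `U`). -/
def IsSolutionOn (U : Set ℂ) (y : ℂ → ℂ) : Prop :=
  U ⊆ E.domain ∧ DifferentiableOn ℂ y U ∧
    ∀ z ∈ U, deriv (deriv y) z
      + (E.γ / z + E.δ / (z - 1) + E.ε / (z - E.t)) * deriv y z
      + (E.α * E.β * z - E.q) / (z * (z - 1) * (z - E.t)) * y z = 0

/-- For `ε = n ∈ ℤ`, the singularity `z = t` (whose exponents are `0` and `1 - n`) is apparent: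
near `z = t` there is a basis of solutions without logarithmic term, that is, a basis
`f = u(z)`, `g = (z - t) ^ (1 - n) * v(z)` with `u, v` holomorphic at `t`, `u(t) ≠ 0`,
`v(t) ≠ 0`. -/
def IsApparent (n : ℤ) : Prop :=
  ∃ r : ℝ, 0 < r ∧ ∃ u v : ℂ → ℂ,
    DifferentiableOn ℂ u (Metric.ball E.t r) ∧ DifferentiableOn ℂ v (Metric.ball E.t r) ∧
    u E.t ≠ 0 ∧ v E.t ≠ 0 ∧
    E.IsSolutionOn (Metric.ball E.t r \ {E.t}) u ∧
    E.IsSolutionOn (Metric.ball E.t r \ {E.t}) (fun z => (z - E.t) ^ (1 - n) * v z) ∧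
    ∀ c₁ c₂ : ℂ,
      (∀ z ∈ Metric.ball E.t r \ {E.t}, c₁ * u z + c₂ * ((z - E.t) ^ (1 - n) * v z) = 0) →
      c₁ = 0 ∧ c₂ = 0

/-- The universal covering space of `ℂ \ {0, 1, t}` with base point `b`, as a set: pairs of a
point `x` and a homotopy class of paths from `b` to `x`. -/
abbrev UniversalCover (b : E.domain) : Type :=
  Σ x : E.domain, Path.Homotopic.Quotient b x

/-- A (multivalued) solution of the Heun equation: a function `F` on the universal cover which
near each point is a holomorphic solution. Namely, for each class `g` of paths from `b` to `x`
there is a disc about `x` and a holomorphic solution `y` on it such that, for every path `s` from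
`x` to `z` inside the disc, the value of `F` at `g` followed by `s` is `y z`. -/
def IsMultivaluedSolution (b : E.domain) (F : E.UniversalCover b → ℂ) : Prop :=
  ∀ (x : E.domain) (g : Path.Homotopic.Quotient b x),
    ∃ r : ℝ, 0 < r ∧ ∃ y : ℂ → ℂ, E.IsSolutionOn (Metric.ball (x : ℂ) r) y ∧
      ∀ (z : E.domain) (s : Path x z), (∀ τ, (s τ : ℂ) ∈ Metric.ball (x : ℂ) r) →
        F ⟨z, g.trans (Path.Homotopic.Quotient.mk s)⟩ = y z

/-- Solutions of the (linear, homogeneous) equation on an open set are closed under linear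
combinations. -/
theorem IsSolutionOn.linComb {U : Set ℂ} (hU : IsOpen U) {y₁ y₂ : ℂ → ℂ}
    (h₁ : E.IsSolutionOn U y₁) (h₂ : E.IsSolutionOn U y₂) (c₁ c₂ : ℂ) :
    E.IsSolutionOn U (fun z => c₁ * y₁ z + c₂ * y₂ z) := by
  obtain ⟨hs, d₁, e₁⟩ := h₁
  obtain ⟨-, d₂, e₂⟩ := h₂
  have key : ∀ {f g : ℂ → ℂ}, DifferentiableOn ℂ f U → DifferentiableOn ℂ g U → ∀ z ∈ U,
      deriv (fun z => c₁ * f z + c₂ * g z) z = c₁ * deriv f z + c₂ * deriv g z := by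
    intro f g hf hg z hz
    have a := (hf.differentiableAt (hU.mem_nhds hz)).hasDerivAt.const_mul c₁
    have b := (hg.differentiableAt (hU.mem_nhds hz)).hasDerivAt.const_mul c₂
    exact (a.add b).deriv
  refine ⟨hs, (d₁.const_mul c₁).add (d₂.const_mul c₂), fun z hz => ?_⟩
  have h2 : deriv (deriv (fun z => c₁ * y₁ z + c₂ * y₂ z)) z
      = c₁ * deriv (deriv y₁) z + c₂ * deriv (deriv y₂) z := by
    rw [← key (d₁.deriv hU) (d₂.deriv hU) z hz]
    apply Filter.EventuallyEq.deriv_eq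
    filter_upwards [hU.mem_nhds hz] with w hw using key d₁ d₂ w hw
  rw [h2, key d₁ d₂ z hz]
  linear_combination c₁ * e₁ z hz + c₂ * e₂ z hz

theorem IsSolutionOn.mono {U V : Set ℂ} (h : V ⊆ U) {y : ℂ → ℂ}
    (hy : E.IsSolutionOn U y) : E.IsSolutionOn V y :=
  ⟨h.trans hy.1, hy.2.1.mono h, fun z hz => hy.2.2 z (h hz)⟩

theorem isMultivaluedSolution_linComb (b : E.domain) {F G : E.UniversalCover b → ℂ}
    (hF : E.IsMultivaluedSolution b F) (hG : E.IsMultivaluedSolution b G) (c₁ c₂ : ℂ) :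
    E.IsMultivaluedSolution b (fun p => c₁ * F p + c₂ * G p) := by
  intro x g
  obtain ⟨r₁, p₁, y₁, s₁, e₁⟩ := hF x g
  obtain ⟨r₂, p₂, y₂, s₂, e₂⟩ := hG x g
  have i₁ := Metric.ball_subset_ball (x := (x : ℂ)) (min_le_left r₁ r₂)
  have i₂ := Metric.ball_subset_ball (x := (x : ℂ)) (min_le_right r₁ r₂)
  refine ⟨min r₁ r₂, lt_min p₁ p₂, fun z => c₁ * y₁ z + c₂ * y₂ z,
    IsSolutionOn.linComb E Metric.isOpen_ball (s₁.mono E i₁) (s₂.mono E i₂) c₁ c₂, ?_⟩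
  intro z s hs
  simp only [e₁ z s fun τ => i₁ (hs τ), e₂ z s fun τ => i₂ (hs τ)]

theorem isMultivaluedSolution_zero (b : E.domain) :
    E.IsMultivaluedSolution b (fun _ => 0) := by
  intro x g
  have ho : IsOpen E.domain := isOpen_ne.inter (isOpen_ne.inter isOpen_ne)
  obtain ⟨r, hr, hs⟩ := Metric.isOpen_iff.1 ho x x.2
  refine ⟨r, hr, fun _ => 0, ⟨hs, differentiableOn_const _, fun z _ => by simp⟩, ?_⟩
  intros
  rfl

/-- The complex vector space of (multivalued) solutions of the Heun equation. -/
def solutions (b : E.domain) : Submodule ℂ (E.UniversalCover b → ℂ) where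
  carrier := {F | E.IsMultivaluedSolution b F}
  zero_mem' := E.isMultivaluedSolution_zero b
  add_mem' {F G} hF hG := by
    have h := E.isMultivaluedSolution_linComb b hF hG 1 1
    simp only [one_mul] at h
    exact h
  smul_mem' c F hF := by
    have h := E.isMultivaluedSolution_linComb b hF hF c 0
    simp only [zero_mul, add_zero] at h
    exact h

theorem isMultivaluedSolution_translate (b : E.domain) (σ : Path.Homotopic.Quotient b b)
    {F : E.UniversalCover b → ℂ} (hF : E.IsMultivaluedSolution b F) :
    E.IsMultivaluedSolution b (fun p => F ⟨p.1, σ.trans p.2⟩) := by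
  intro x g
  obtain ⟨r, hr, y, hy, e⟩ := hF x (σ.trans g)
  refine ⟨r, hr, y, hy, fun z s hs => ?_⟩
  rw [← e z s hs]
  exact congrArg (fun k => F ⟨z, k⟩) (CategoryTheory.Category.assoc
    (W := FundamentalGroupoid.mk b) (X := FundamentalGroupoid.mk b)
    (Y := FundamentalGroupoid.mk x) (Z := FundamentalGroupoid.mk z)
    σ g (Path.Homotopic.Quotient.mk s)).symm

/-- The monodromy representation of the fundamental group of `ℂ \ {0, 1, t}` on the space of
solutions: the class of a loop `σ` sends `F` to its analytic continuation along `σ`, that is, to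
`g ↦ F (σ followed by g)`. -/
def monodromy (b : E.domain) :
    Representation ℂ (FundamentalGroup E.domain b) (E.solutions b) where
  toFun σ :=
    { toFun := fun F => ⟨fun p => F.1 ⟨p.1, Path.Homotopic.Quotient.trans σ.toPath p.2⟩,
        E.isMultivaluedSolution_translate b σ.toPath F.2⟩
      map_add' := fun _ _ => rfl
      map_smul' := fun _ _ => rfl }
  map_one' := by
    ext F p
    exact congrArg (fun k => F.1 ⟨p.1, k⟩) (CategoryTheory.Category.id_comp
      (X := FundamentalGroupoid.mk b) (Y := FundamentalGroupoid.mk p.1) p.2)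
  map_mul' σ σ' := by
    ext F p
    exact congrArg (fun k => F.1 ⟨p.1, k⟩) (CategoryTheory.Category.assoc
      (W := FundamentalGroupoid.mk b) (X := FundamentalGroupoid.mk b)
      (Y := FundamentalGroupoid.mk b) (Z := FundamentalGroupoid.mk p.1) σ'.toPath σ.toPath p.2)

/-- The monodromy representation with base point `b` is reducible: there is an invariant
subspace other than zero and the whole space of solutions. -/
def IsMonodromyReducible (b : E.domain) : Prop :=
  ∃ W : Subrepresentation (E.monodromy b), W ≠ ⊥ ∧ W ≠ ⊤

end HeunEquation

end

/-! It suffices to find a solution `z^a (z-1)^b (z-t)^c p(z)` with `p ≠ 0` a polynomial: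
continuation multiplies it by constants, so it spans an invariant line, proper because solutions
through `b` realise all 1-jets in `ℂ × ℂ`.

Suppose `ε = -N ≤ 0`. Let `L` be the Heun operator with denominators cleared and `L'` its conjugate
by `z^(1-γ) (z-1)^(1-δ)`. Apparentness gives both equations holomorphic solutions nonzero at `t`;
truncation at order `N` yields polynomials `g, h` of degree at most `N` with `L g` and `L' h`
divisible by `(X-t)^(N+1)`. By `lagrange`, `h L p - p L' h = (X-t) B' - N B`, which has no `(X-t)^N`
term. If `α = -k ≤ 0`, then `L` preserves polynomials of degree at most `k`: either it has a kernel,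
or `L p = 1` is solvable. In the latter case the identity kills the top coefficient of `h`; then `L'
h` has degree at most `N` and is divisible by `(X-t)^(N+1)`, hence is zero. If `α ≥ 1`, the roles of
`L` and `L'` are exchanged (`exists_polynomial_solution`).

The value `ε = 1` contradicts apparentness; `ε ≥ 2` reduces to `2 - ε ≤ 0` on dividing by
`(z-t)^(1-ε)`. -/

open Topology Polynomial

/-! ### Continuation along path classes, through covering spaces with discrete fibre. -/

section Transport

variable {X F : Type*} [TopologicalSpace X]

/-- Induction along a path class: a property of the path classes issuing from `x` which holds for
the constant path and does not change under short paths holds for all of them. -/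
theorem Path.Homotopic.Quotient.induction_short {x : X} {U : X → Set X}
    (hU : ∀ c, U c ∈ 𝓝 c) (Φ : ∀ z : X, Path.Homotopic.Quotient x z → Prop)
    (h0 : Φ x (Path.Homotopic.Quotient.mk (Path.refl x)))
    (hs : ∀ (c : X) (g : Path.Homotopic.Quotient x c) (z : X) (s : Path c z),
      (∀ τ, s τ ∈ U c) → (Φ c g ↔ Φ z (g.trans (Path.Homotopic.Quotient.mk s))))
    {y : X} (g : Path.Homotopic.Quotient x y) : Φ y g := by
  induction g using Path.Homotopic.Quotient.ind with
  | mk γ => ?_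
  let sp : ∀ τ, Path x (γ τ) := fun τ => (γ.subpath 0 τ).cast γ.source.symm rfl
  -- Truth of `Φ` on the initial segments of `γ` is locally constant in the parameter, hence
  -- constant on the connected unit interval.
  have hlc : IsLocallyConstant (fun τ => Φ (γ τ) (Path.Homotopic.Quotient.mk (sp τ))) := by
    rw [IsLocallyConstant.iff_eventually_eq]
    intro τ₀
    have hn : γ ⁻¹' U (γ τ₀) ∈ 𝓝 τ₀ := γ.continuous.continuousAt.preimage_mem_nhds (hU _)
    obtain ⟨J, ⟨hJ, hJc⟩, hJU⟩ := (LocallyConvexSpace.convex_basis (𝕜 := ℝ) (E := ℝ) (τ₀ : ℝ)).comap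
      ((↑) : unitInterval → ℝ) |>.mem_iff.1 (by rw [← nhds_subtype_eq_comap]; exact hn)
    have hJn : ((↑) : unitInterval → ℝ) ⁻¹' J ∈ 𝓝 τ₀ :=
      continuous_subtype_val.continuousAt.preimage_mem_nhds hJ
    filter_upwards [hJn] with τ hτ
    have hr : ∀ σ, γ.subpath τ₀ τ σ ∈ U (γ τ₀) := by
      intro σ
      have : γ.subpath τ₀ τ σ ∈ γ '' (Set.uIcc τ₀ τ) := by
        rw [← Path.range_subpath]; exact ⟨σ, rfl⟩
      obtain ⟨ρ, hρ, e⟩ := this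
      rw [← e]
      apply hJU
      have hc := hJc.ordConnected.uIcc_subset (mem_of_mem_nhds hJ) hτ
      exact hc ⟨hρ.1, hρ.2⟩
    have key := hs (γ τ₀) (Path.Homotopic.Quotient.mk (sp τ₀)) (γ τ) (γ.subpath τ₀ τ) hr
    have e : (Path.Homotopic.Quotient.mk (sp τ₀)).trans
        (Path.Homotopic.Quotient.mk (γ.subpath τ₀ τ)) = Path.Homotopic.Quotient.mk (sp τ) := by
      rw [← Path.Homotopic.Quotient.mk_trans, Path.Homotopic.Quotient.eq]
      have H := Path.Homotopy.subpathTransSubpath γ 0 τ₀ τ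
      exact ⟨H.cast rfl rfl⟩
    rw [e] at key
    exact propext key.symm
  -- The endpoints `γ 0`, `x` and `γ 1`, `y` are only propositionally equal, so `Φ` is moved between
  -- paths with the same values.
  have hΦ : ∀ {z z' : X} (p : Path x z) (p' : Path x z'), (∀ τ, p τ = p' τ) →
      Φ z (Path.Homotopic.Quotient.mk p) → Φ z' (Path.Homotopic.Quotient.mk p') := by
    intro z z' p p' h hp
    obtain rfl : z = z' := by simpa using h 1
    obtain rfl : p = p' := by ext τ; exact h τ
    exact hp
  have h1 := hlc.apply_eq_of_preconnectedSpace 0 1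
  have h2 : Φ (γ 0) (Path.Homotopic.Quotient.mk (sp 0)) :=
    hΦ (Path.refl x) (sp 0) (fun τ => by simp [sp]) h0
  rw [h1] at h2
  exact hΦ (sp 1) γ (fun τ => by simp [sp]) h2

/-- Data of a locally constant family: neighbourhoods `U c` and, for each `c`, a family of maps
`D c z : F → F` (continuation from `c` to `z ∈ U c`) such that two continuations which agree at a
point of `U c ∩ U c'` agree on all of it. -/
structure LocalTransport (X F : Type*) [TopologicalSpace X] where
  U : X → Set X
  isOpen_U : ∀ c, IsOpen (U c)
  mem_U : ∀ c, c ∈ U c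
  D : X → X → F → F
  D_self : ∀ c v, D c c v = v
  bijective : ∀ c, ∀ z ∈ U c, Function.Bijective (D c z)
  agree : ∀ c c' v v', ∀ z ∈ U c ∩ U c', D c z v = D c' z v' →
    ∀ z' ∈ U c ∩ U c', D c z' v = D c' z' v'

namespace LocalTransport

variable (S : LocalTransport X F)

/-- The value at `z` read in the chart of `c'`, for a value read in the chart of `c`. -/
noncomputable def change (c c' z : X) (v : F) : F :=
  haveI : Nonempty F := ⟨v⟩
  Function.invFun (S.D c' z) (S.D c z v)

theorem D_change {c c' z : X} (hz : z ∈ S.U c') (v : F) :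
    S.D c' z (S.change c c' z v) = S.D c z v := by
  have : Nonempty F := ⟨v⟩
  exact Function.invFun_eq ((S.bijective c' z hz).2 _)

theorem change_eq_iff {c c' z : X} (hz : z ∈ S.U c') (v w : F) :
    S.change c c' z v = w ↔ S.D c z v = S.D c' z w := by
  rw [← S.D_change hz v]
  exact ⟨fun h => by rw [h], fun h => (S.bijective c' z hz).1 h⟩

/-- The fiber bundle with discrete fiber defined by a locally constant family. -/
noncomputable def core [TopologicalSpace F] [DiscreteTopology F] : FiberBundleCore X X F where
  baseSet := S.U
  isOpen_baseSet := S.isOpen_U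
  indexAt := id
  mem_baseSet_at := S.mem_U
  coordChange := S.change
  coordChange_self c z hz v := (S.change_eq_iff hz v v).2 rfl
  continuousOn_coordChange c c' := by
    rintro ⟨z, v⟩ ⟨hz, -⟩
    -- As `F` is discrete, only the base point varies; `agree` then makes the chart change locally
    -- constant.
    have hev : ∀ᶠ p : X × F in 𝓝 (z, v), S.change c c' p.1 p.2 = S.change c c' z v := by
      rw [nhds_prod_eq, nhds_discrete F, Filter.prod_pure, Filter.eventually_map]
      filter_upwards [(S.isOpen_U c).mem_nhds hz.1, (S.isOpen_U c').mem_nhds hz.2] with w hw hw'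
      rw [S.change_eq_iff hw']
      exact S.agree c c' _ _ z hz (S.D_change hz.2 v).symm w ⟨hw, hw'⟩
    exact ((continuousAt_const (y := S.change c c' z v)).congr
      (hev.mono fun _ h => h.symm)).continuousWithinAt
  coordChange_comp i j k z hz v := by
    rw [S.change_eq_iff hz.2, S.D_change hz.1.2, S.D_change hz.2]

section Covering

variable [TopologicalSpace F] [DiscreteTopology F]

theorem isCoveringMap_core : IsCoveringMap S.core.proj :=
  IsCoveringMap.mk _ (fun _ => F) S.core.localTriv S.mem_U

end Covering

/-- Every locally constant family has a transport along classes of paths. -/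
theorem exists_transport : ∃ T : ∀ {x y : X}, Path.Homotopic.Quotient x y → F → F,
    (∀ x v, T (Path.Homotopic.Quotient.mk (Path.refl x)) v = v) ∧
    (∀ {x y z : X} (g : Path.Homotopic.Quotient x y) (h : Path.Homotopic.Quotient y z) (v : F),
      T (g.trans h) v = T h (T g v)) ∧
    (∀ {c z : X} (s : Path c z), (∀ τ, s τ ∈ S.U c) → ∀ v,
      T (Path.Homotopic.Quotient.mk s) v = S.D c z v) := by
  let _ : TopologicalSpace F := ⊥
  have : DiscreteTopology F := ⟨rfl⟩
  have cov := S.isCoveringMap_core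
  let pt : ∀ x : X, F → S.core.proj ⁻¹' {x} := fun x v => ⟨⟨x, v⟩, rfl⟩
  have hpt : ∀ (x : X) (e : S.core.proj ⁻¹' {x}), pt x e.1.2 = e := by
    rintro x ⟨⟨x', v⟩, h⟩
    obtain rfl : x' = x := h
    rfl
  have hb : ∀ {a a' : X} (w : F), a = a' → (⟨a, w⟩ : S.core.TotalSpace) = ⟨a', w⟩ := by
    rintro a _ w rfl
    rfl
  refine ⟨fun {x y} g v => (cov.monodromy g (pt x v)).1.2, ?_, ?_, ?_⟩
  · intro x v
    have := congrFun (cov.monodromy_refl (x := x)) (pt x v)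
    exact congrArg (fun e : S.core.proj ⁻¹' {x} => (e.1.2 : F)) this
  · intro x y z g h v
    change (cov.monodromy (g.trans h) (pt x v)).1.2 =
      (cov.monodromy h (pt y (cov.monodromy g (pt x v)).1.2)).1.2
    rw [cov.monodromy_trans_apply, hpt]
  · intro c z s hs v
    -- In the chart of `c` the lift of `s` is constant, equal to `v`; uniqueness of lifts identifies
    -- it with the monodromy.
    let Γ : unitInterval → S.core.TotalSpace := fun τ => ⟨s τ, S.D c (s τ) v⟩
    have hΓ : Continuous Γ := by
      have h1 : Continuous fun τ => (S.core.localTriv c).toOpenPartialHomeomorph.symm (s τ, v) :=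
        (S.core.localTriv c).toOpenPartialHomeomorph.continuousOn_symm.comp_continuous
          (by fun_prop) fun τ => (S.core.mem_localTriv_target c (s τ, v)).2 (hs τ)
      refine h1.congr fun τ => ?_
      change (⟨s τ, S.change c (s τ) (s τ) v⟩ : S.core.TotalSpace) = ⟨s τ, S.D c (s τ) v⟩
      rw [(S.change_eq_iff (S.mem_U _) _ _).2 (S.D_self _ _).symm]
    have hl := (cov.eq_liftPath_iff (γ := (s : C(unitInterval, X))) (e := ⟨c, v⟩) s.source
      (Γ := Γ)).2 ⟨hΓ, rfl, by simpa only [Γ, s.source, S.D_self] using hb v s.source⟩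
    have h1 : Γ 1 = (cov.monodromy (Path.Homotopic.Quotient.mk s) (pt c v)).1 :=
      congrFun hl 1
    have hz : ∀ {a a' : X} {w w' : F}, (⟨a, w⟩ : S.core.TotalSpace) = ⟨a', w'⟩ → w = w' := by
      rintro a a' w w' h
      cases h
      rfl
    have h2 : Γ 1 = ⟨z, S.D c z v⟩ := by
      simpa only [Γ, s.target] using hb (S.D c z v) s.target
    rw [h2] at h1
    change (cov.monodromy (Path.Homotopic.Quotient.mk s) (pt c v)).1.2 = S.D c z v
    rw [← h1]

end LocalTransport

end Transport

/-! ### Power series solutions at an ordinary point. -/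

section PowerSeriesSolution

open Filter

/-- `f` is the sum of the power series with coefficients `a` on the disc of radius `r`. -/
def IsPowerSum (r : ℝ) (a : ℕ → ℂ) (f : ℂ → ℂ) : Prop :=
  ∀ w ∈ Metric.ball (0 : ℂ) r, HasSum (fun k => a k * w ^ k) (f w)

theorem HasSum.of_eq {f g : ℕ → ℂ} {s s' : ℂ} (h : HasSum f s) (hg : ∀ k, g k = f k)
    (hs : s' = s) : HasSum g s' := by
  rwa [hs, funext hg]

theorem hasSum_of_zero_of_succ {f : ℕ → ℂ} {s : ℂ} (h0 : f 0 = 0)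
    (h : HasSum (fun k => f (k + 1)) s) : HasSum f s := by
  simpa [h0] using (hasSum_nat_add_iff 1).1 h

namespace IsPowerSum

variable {r : ℝ} {a c : ℕ → ℂ} {f : ℂ → ℂ}

theorem apply_zero (hr : 0 < r) (h : IsPowerSum r a f) : f 0 = a 0 := by
  refine (h 0 (Metric.mem_ball_self hr)).unique ?_
  refine (hasSum_single (f := fun k => a k * (0 : ℂ) ^ k) 0 ?_).of_eq (fun _ => rfl) (by simp)
  intro k hk
  simp [hk]

/-- The shifted sequence `c` is a parameter, so that it can be supplied in closed form, including at
index `0`. -/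
theorem mul_id (h : IsPowerSum r a f) (h0 : c 0 = 0) (hc : ∀ k, c (k + 1) = a k) :
    IsPowerSum r c (fun w => w * f w) := by
  intro w hw
  refine hasSum_of_zero_of_succ (by simp [h0]) ?_
  refine ((h w hw).mul_left w).of_eq (fun k => ?_) rfl
  rw [hc]
  ring

/-- At a radius `ρ` strictly between `‖w‖` and `r` the series converges absolutely and dominates all
terms on the smaller disc, so termwise differentiation is allowed. -/
theorem deriv (h : IsPowerSum r a f) :
    DifferentiableOn ℂ f (Metric.ball 0 r) ∧
      IsPowerSum r (fun k => (k + 1) * a (k + 1)) (deriv f) := by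
  have main : ∀ w ∈ Metric.ball (0 : ℂ) r, DifferentiableAt ℂ f w ∧
      HasSum (fun k : ℕ => ((k + 1) * a (k + 1)) * w ^ k) (_root_.deriv f w) := by
    intro w hw
    rw [mem_ball_zero_iff] at hw
    obtain ⟨ρ, h1, h2⟩ := exists_between hw
    have hρ : 0 ≤ ρ := (norm_nonneg w).trans h1.le
    have hu : Summable fun k => ‖a k * (ρ : ℂ) ^ k‖ :=
      (h ρ (by simpa [abs_of_nonneg hρ] using h2)).summable.norm
    have hd : ∀ k, DifferentiableOn ℂ (fun w => a k * w ^ k) (Metric.ball 0 ρ) :=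
      fun k => by fun_prop
    have hle : ∀ (k : ℕ), ∀ z ∈ Metric.ball (0 : ℂ) ρ, ‖a k * z ^ k‖ ≤ ‖a k * (ρ : ℂ) ^ k‖ := by
      intro k z hz
      rw [mem_ball_zero_iff] at hz
      rw [norm_mul, norm_mul, norm_pow, norm_pow, Complex.norm_real, Real.norm_of_nonneg hρ]
      gcongr
    have hwρ : w ∈ Metric.ball (0 : ℂ) ρ := by simpa using h1
    have hs := Complex.hasSum_deriv_of_summable_norm hu hd Metric.isOpen_ball hle hwρ
    have hdf := Complex.differentiableOn_tsum_of_summable_norm hu hd Metric.isOpen_ball hle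
    have he : ∀ z ∈ Metric.ball (0 : ℂ) ρ, ∑' k, a k * z ^ k = f z := fun z hz =>
      (h z (Metric.ball_subset_ball h2.le hz)).tsum_eq
    have hev : (fun z => ∑' k, a k * z ^ k) =ᶠ[𝓝 w] f :=
      Filter.eventuallyEq_of_mem (Metric.isOpen_ball.mem_nhds hwρ) he
    refine ⟨((hdf.differentiableAt (Metric.isOpen_ball.mem_nhds hwρ))).congr_of_eventuallyEq
      hev.symm, ?_⟩
    rw [hev.deriv_eq] at hs
    have hs' := (hasSum_nat_add_iff' 1).2 hs
    refine hs'.of_eq (fun k => ?_) ?_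
    · simp
      ring
    · simp
  exact ⟨fun w hw => (main w hw).1.differentiableWithinAt, fun w hw => (main w hw).2⟩

end IsPowerSum

theorem exists_three_term_seq (F : ℕ → ℂ → ℂ → ℂ → ℂ) (x₀ x₁ x₂ : ℂ) :
    ∃ b : ℕ → ℂ, b 0 = x₀ ∧ b 1 = x₁ ∧ b 2 = x₂ ∧
      ∀ k, b (k + 3) = F k (b k) (b (k + 1)) (b (k + 2)) := by
  let g : ℕ → ℂ × ℂ × ℂ := fun n =>
    Nat.rec (x₀, x₁, x₂) (fun k p => (p.2.1, p.2.2, F k p.1 p.2.1 p.2.2)) n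
  exact ⟨fun k => (g k).1, rfl, rfl, rfl, fun k => rfl⟩

/-- With `R = 3K + 1 ≥ 1`, the three preceding terms are all bounded by the latest bound `C * R ^ (k
+ 2)`, and `3K ≤ R`. -/
theorem norm_le_of_three_term {b : ℕ → ℂ} {K : ℝ} (hK : 0 ≤ K)
    (hb : ∀ k, ‖b (k + 3)‖ ≤ K * (‖b k‖ + ‖b (k + 1)‖ + ‖b (k + 2)‖)) (k : ℕ) :
    ‖b k‖ ≤ (‖b 0‖ + ‖b 1‖ + ‖b 2‖) * (3 * K + 1) ^ k := by
  set C := ‖b 0‖ + ‖b 1‖ + ‖b 2‖ with hC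
  have h0 := norm_nonneg (b 0)
  have h1 := norm_nonneg (b 1)
  have h2 := norm_nonneg (b 2)
  have hC0 : 0 ≤ C := by positivity
  have hR : 1 ≤ 3 * K + 1 := by linarith
  set R := 3 * K + 1 with hRdef
  have main : ∀ k, ‖b k‖ ≤ C * R ^ k ∧ ‖b (k + 1)‖ ≤ C * R ^ (k + 1) ∧
      ‖b (k + 2)‖ ≤ C * R ^ (k + 2) := by
    intro k
    induction k with
    | zero =>
      refine ⟨?_, ?_, ?_⟩
      · simp only [pow_zero]; linarith
      · exact le_trans (by simp only [Nat.zero_add]; linarith)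
          (le_mul_of_one_le_right hC0 (one_le_pow₀ hR))
      · exact le_trans (by simp only [Nat.zero_add]; linarith)
          (le_mul_of_one_le_right hC0 (one_le_pow₀ hR))
    | succ k ih =>
      obtain ⟨i0, i1, i2⟩ := ih
      refine ⟨i1, i2, (hb k).trans ?_⟩
      have e0 : C * R ^ k ≤ C * R ^ (k + 2) := by gcongr; simp
      have e1 : C * R ^ (k + 1) ≤ C * R ^ (k + 2) := by gcongr; simp
      calc K * (‖b k‖ + ‖b (k + 1)‖ + ‖b (k + 2)‖)
          ≤ K * (C * R ^ (k + 2) + C * R ^ (k + 2) + C * R ^ (k + 2)) := by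
            gcongr <;> linarith
        _ = (R - 1) * (C * R ^ (k + 2)) := by rw [hRdef]; ring
        _ ≤ R * (C * R ^ (k + 2)) := by
            gcongr
            linarith
        _ = C * R ^ (k + 1 + 2) := by ring
  exact (main k).1

/-- Local solutions of a second order linear equation with polynomial coefficients at an ordinary
point, on a disc which does not depend on the initial values. -/
theorem exists_local_solution_zero (p₀ p₁ p₂ p₃ q₀ q₁ q₂ r₀ r₁ : ℂ) (hp : p₀ ≠ 0) :
    ∃ r : ℝ, 0 < r ∧ ∀ u v : ℂ, ∃ f : ℂ → ℂ, DifferentiableOn ℂ f (Metric.ball 0 r) ∧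
      f 0 = u ∧ deriv f 0 = v ∧ ∀ w ∈ Metric.ball (0 : ℂ) r,
        (p₀ + p₁ * w + p₂ * w ^ 2 + p₃ * w ^ 3) * deriv (deriv f) w
          + (q₀ + q₁ * w + q₂ * w ^ 2) * deriv f w + (r₀ + r₁ * w) * f w = 0 := by
  -- For `f = ∑ b (k + 1) w ^ k`, the coefficient of `w ^ k` in the equation is `den k * b (k+3) + D
  -- k * b (k+2) + B k * b (k+1) + A k * b k`.
  let A : ℕ → ℂ := fun k => p₃ * (k - 2) * (k - 1) + q₂ * (k - 1) + r₁
  let B : ℕ → ℂ := fun k => p₂ * (k - 1) * k + q₁ * k + r₀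
  let D : ℕ → ℂ := fun k => p₁ * k * (k + 1) + q₀ * (k + 1)
  let den : ℕ → ℂ := fun k => p₀ * (k + 1) * (k + 2)
  have hk1 : ∀ k : ℕ, ((k : ℂ) + 1) ≠ 0 := fun k => by exact_mod_cast Nat.succ_ne_zero k
  have hk2 : ∀ k : ℕ, ((k : ℂ) + 2) ≠ 0 := fun k => by exact_mod_cast Nat.succ_ne_zero (k + 1)
  have hden : ∀ k, den k ≠ 0 := fun k => mul_ne_zero (mul_ne_zero hp (hk1 k)) (hk2 k)
  set M : ℝ := ‖p₁‖ + ‖p₂‖ + ‖p₃‖ + ‖q₀‖ + ‖q₁‖ + ‖q₂‖ + ‖r₀‖ + ‖r₁‖ with hM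
  have hp0 : 0 < ‖p₀‖ := norm_pos_iff.2 hp
  set K : ℝ := M / ‖p₀‖ with hKdef
  have hM0 : 0 ≤ M := by positivity
  have hK : 0 ≤ K := by positivity
  have nk : ∀ k : ℕ, ‖(k : ℂ)‖ ≤ k + 1 := fun k => by simp
  have nk1 : ∀ k : ℕ, ‖(k : ℂ) + 1‖ = k + 1 := fun k => by
    exact_mod_cast Complex.norm_natCast (k + 1)
  have nk2 : ∀ k : ℕ, ‖(k : ℂ) + 2‖ = k + 2 := fun k => by
    exact_mod_cast Complex.norm_natCast (k + 2)
  have nkm1 : ∀ k : ℕ, ‖(k : ℂ) - 1‖ ≤ k + 1 := fun k => by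
    refine (norm_sub_le _ _).trans ?_
    simp
  have nkm2 : ∀ k : ℕ, ‖(k : ℂ) - 2‖ ≤ k + 2 := fun k => by
    refine (norm_sub_le _ _).trans ?_
    simp
  -- Numerators grow at most quadratically in `k`, as does `den k`; the ratios are therefore bounded
  -- by a constant independent of the initial values.
  have bound : ∀ (k : ℕ) (x y z : ℂ), ‖x‖ ≤ k + 2 → ‖y‖ ≤ k + 1 → ‖z‖ ≤ k + 1 →
      ∀ a b c : ℂ, ‖a‖ + ‖b‖ + ‖c‖ ≤ M → ‖(a * x * y + b * z + c) / den k‖ ≤ K := by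
    intro k x y z hx hy hz a b c hM
    have hk : (0 : ℝ) ≤ k := Nat.cast_nonneg k
    have e : ‖den k‖ = ‖p₀‖ * ((k + 1) * (k + 2)) := by
      simp only [den, norm_mul, nk1, nk2]
      ring
    rw [norm_div, e, hKdef, div_le_div_iff₀ (by positivity) hp0]
    have h1 : ‖a * x * y + b * z + c‖ ≤ M * ((k + 1) * (k + 2)) := by
      calc ‖a * x * y + b * z + c‖ ≤ ‖a * x * y‖ + ‖b * z‖ + ‖c‖ := norm_add₃_le
        _ = ‖a‖ * (‖x‖ * ‖y‖) + ‖b‖ * ‖z‖ + ‖c‖ := by simp only [norm_mul]; ring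
        _ ≤ ‖a‖ * (((k : ℝ) + 2) * (k + 1)) + ‖b‖ * (((k : ℝ) + 2) * (k + 1))
            + ‖c‖ * (((k : ℝ) + 2) * (k + 1)) := by
            gcongr
            · nlinarith
            · exact le_mul_of_one_le_right (norm_nonneg c) (by nlinarith)
        _ = (‖a‖ + ‖b‖ + ‖c‖) * (((k : ℝ) + 1) * (k + 2)) := by ring
        _ ≤ M * (((k : ℝ) + 1) * (k + 2)) := by gcongr
    nlinarith
  have hA : ∀ k, ‖A k / den k‖ ≤ K := fun k =>
    bound k _ _ _ (nkm2 k) (nkm1 k) (nkm1 k) p₃ q₂ r₁ (by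
      have := norm_nonneg p₁; have := norm_nonneg p₂; have := norm_nonneg q₀
      have := norm_nonneg q₁; have := norm_nonneg r₀; linarith)
  have hB : ∀ k, ‖B k / den k‖ ≤ K := fun k =>
    bound k _ _ _ ((nkm1 k).trans (by linarith)) (nk k) (nk k) p₂ q₁ r₀ (by
      have := norm_nonneg p₁; have := norm_nonneg p₃; have := norm_nonneg q₀
      have := norm_nonneg q₂; have := norm_nonneg r₁; linarith)
  have hD : ∀ k, ‖D k / den k‖ ≤ K := fun k => by
    have := bound k _ _ _ ((nk k).trans (by linarith)) (nk1 k).le (nk1 k).le p₁ q₀ 0 (by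
      have := norm_nonneg p₂; have := norm_nonneg p₃; have := norm_nonneg r₀
      have := norm_nonneg q₂; have := norm_nonneg r₁; have := norm_nonneg q₁
      rw [norm_zero]; linarith)
    simpa [D] using this
  set R : ℝ := 3 * K + 1 with hR
  have hR0 : 0 < R := by positivity
  refine ⟨R⁻¹, by positivity, fun u v => ?_⟩
  -- The indices are shifted by one: `b 0 = 0` stands for the coefficient of `w ^ (-1)`, so one
  -- recursion covers every `k`.
  obtain ⟨b, b0, b1, b2, hb⟩ := exists_three_term_seq
    (fun k x y z => -(A k / den k * x + B k / den k * y + D k / den k * z)) 0 u v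
  have hbn := norm_le_of_three_term hK (b := b) (fun k => by
    rw [hb, norm_neg]
    calc _ ≤ ‖A k / den k * b k‖ + ‖B k / den k * b (k + 1)‖ + ‖D k / den k * b (k + 2)‖ :=
          norm_add₃_le
      _ ≤ K * ‖b k‖ + K * ‖b (k + 1)‖ + K * ‖b (k + 2)‖ := by
          rw [norm_mul, norm_mul, norm_mul]
          gcongr
          exacts [hA k, hB k, hD k]
      _ = _ := by ring)
  set C := ‖b 0‖ + ‖b 1‖ + ‖b 2‖
  have hrec : ∀ k, p₀ * (k + 1) * (k + 2) * b (k + 3) + D k * b (k + 2) + B k * b (k + 1)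
      + A k * b k = 0 := by
    intro k
    have h := hb k
    have hd := hden k
    change den k * b (k + 3) + _ + _ + _ = 0
    rw [h]
    field_simp
    ring
  have hf : IsPowerSum R⁻¹ (fun k => b (k + 1)) (fun w => ∑' k, b (k + 1) * w ^ k) := by
    intro w hw
    rw [mem_ball_zero_iff] at hw
    refine Summable.hasSum (Summable.of_norm_bounded
      (g := fun k => C * R * (R * ‖w‖) ^ k) ?_ fun k => ?_)
    · refine (summable_geometric_of_lt_one (by positivity) ?_).mul_left _
      rwa [← lt_inv_mul_iff₀ hR0, mul_one]
    · rw [norm_mul, norm_pow]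
      calc ‖b (k + 1)‖ * ‖w‖ ^ k ≤ C * R ^ (k + 1) * ‖w‖ ^ k := by
            gcongr
            exact hbn (k + 1)
        _ = C * R * (R * ‖w‖) ^ k := by rw [mul_pow, pow_succ]; ring
  set f : ℂ → ℂ := fun w => ∑' k, b (k + 1) * w ^ k
  obtain ⟨df, hf1⟩ := hf.deriv
  obtain ⟨-, hf2⟩ := hf1.deriv
  have hr : 0 < R⁻¹ := by positivity
  refine ⟨f, df, by rw [hf.apply_zero hr, b1], by rw [hf1.apply_zero hr]; simp [b2], ?_⟩
  intro w hw
  have xf := hf.mul_id (c := b) b0 (fun k => rfl)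
  have xf1 := hf1.mul_id (c := fun k => k * b (k + 1)) (by simp) (fun k => by push_cast; ring_nf)
  have xxf1 := xf1.mul_id (c := fun k => (k - 1) * b k) (by simp [b0]) (fun k => by
    push_cast; ring_nf)
  have xf2 := hf2.mul_id (c := fun k => k * (k + 1) * b (k + 2)) (by simp) (fun k => by
    push_cast; ring_nf)
  have xxf2 := xf2.mul_id (c := fun k => (k - 1) * k * b (k + 1)) (by simp) (fun k => by
    push_cast; ring_nf)
  have xxxf2 := xxf2.mul_id (c := fun k => (k - 2) * (k - 1) * b k) (by simp [b0]) (fun k => by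
    push_cast; ring_nf)
  have total := (((((((((hf2 w hw).mul_left p₀).add ((xf2 w hw).mul_left p₁)).add
    ((xxf2 w hw).mul_left p₂)).add ((xxxf2 w hw).mul_left p₃)).add
    ((hf1 w hw).mul_left q₀)).add ((xf1 w hw).mul_left q₁)).add ((xxf1 w hw).mul_left q₂)).add
    ((hf w hw).mul_left r₀)).add ((xf w hw).mul_left r₁)
  have h0 := total.unique ((hasSum_zero (α := ℂ) (β := ℕ)).of_eq (fun k => by
    have := hrec k
    simp only [A, B, D] at this
    push_cast
    linear_combination w ^ k * this) rfl)
  linear_combination h0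

end PowerSeriesSolution

/-! ### Existence and uniqueness of local solutions. -/

section LocalTheory

open Filter

/-- Derivatives of a function with a zero of order `j + 1`. -/
theorem eventually_deriv_of_eq_pow_mul {f s : ℂ → ℂ} {c : ℂ} {j : ℕ} (hs : AnalyticAt ℂ s c)
    (hf : ∀ᶠ z in 𝓝 c, f z = (z - c) ^ (j + 1) * s z) :
    ∀ᶠ z in 𝓝 c, deriv f z = (z - c) ^ j * ((j + 1) * s z + (z - c) * deriv s z) ∧
      (z - c) * deriv (deriv f) z = (z - c) ^ j * ((j + 1) * j * s z
        + 2 * (j + 1) * (z - c) * deriv s z + (z - c) ^ 2 * deriv (deriv s) z) := by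
  have hpow : ∀ (k : ℕ) (z : ℂ), HasDerivAt (fun z => (z - c) ^ k) (k * (z - c) ^ (k - 1)) z :=
    fun k z => by simpa using ((hasDerivAt_id z).sub_const c).fun_pow k
  have h1 : ∀ᶠ z in 𝓝 c, deriv f z = (z - c) ^ j * ((j + 1) * s z + (z - c) * deriv s z) := by
    filter_upwards [hf.eventually_nhds, hs.eventually_analyticAt] with z hz hsz
    rw [Filter.EventuallyEq.deriv_eq hz]
    refine ((hpow (j + 1) z).mul hsz.differentiableAt.hasDerivAt).deriv.trans ?_
    simp only [Nat.add_sub_cancel]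
    push_cast
    ring
  refine h1.and ?_
  filter_upwards [h1.eventually_nhds, hs.eventually_analyticAt,
    hs.deriv.eventually_analyticAt] with z hz hsz hsz'
  rw [Filter.EventuallyEq.deriv_eq hz]
  have hd := (hpow j z).mul ((hsz.differentiableAt.hasDerivAt.const_mul ((j : ℂ) + 1)).add
    (((hasDerivAt_id z).sub_const c).mul hsz'.differentiableAt.hasDerivAt))
  have hd' := hd.deriv
  have e : (z - c) * (j * (z - c) ^ (j - 1)) = j * (z - c) ^ j := by
    cases j with
    | zero => simp
    | succ k => simp only [Nat.add_sub_cancel]; ring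
  refine (congrArg ((z - c) * ·) hd').trans ?_
  simp only [Pi.add_apply, Pi.mul_apply, id_eq]
  linear_combination ((j + 1) * s z + (z - c) * deriv s z) * e

theorem eq_zero_of_continuousAt_of_eventually {h : ℂ → ℂ} {c : ℂ} (hc : ContinuousAt h c)
    (he : ∀ᶠ z in 𝓝[≠] c, h z = 0) : h c = 0 :=
  ((hc.eventuallyEq_nhds_iff_eventuallyEq_nhdsNE continuousAt_const).1 he).eq_of_nhds

namespace HeunEquation

variable (E : HeunEquation)

theorem isOpen_domain : IsOpen E.domain := isOpen_ne.inter (isOpen_ne.inter isOpen_ne)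

/-- The Heun operator with polynomial coefficients, applied to a 2-jet at `z`. -/
def op (y₂ y₁ y₀ z : ℂ) : ℂ :=
  z * (z - 1) * (z - E.t) * y₂
    + (E.γ * ((z - 1) * (z - E.t)) + E.δ * (z * (z - E.t)) + E.ε * (z * (z - 1))) * y₁
    + (E.α * E.β * z - E.q) * y₀

theorem op_eq_zero_iff {z : ℂ} (hz : z ∈ E.domain) (y₂ y₁ y₀ : ℂ) :
    E.op y₂ y₁ y₀ z = 0 ↔ y₂ + (E.γ / z + E.δ / (z - 1) + E.ε / (z - E.t)) * y₁
      + (E.α * E.β * z - E.q) / (z * (z - 1) * (z - E.t)) * y₀ = 0 := by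
  obtain ⟨h0, h1, ht⟩ := hz
  have h1' := sub_ne_zero.2 h1
  have ht' := sub_ne_zero.2 ht
  have e : E.op y₂ y₁ y₀ z = (z * (z - 1) * (z - E.t)) *
      (y₂ + (E.γ / z + E.δ / (z - 1) + E.ε / (z - E.t)) * y₁
      + (E.α * E.β * z - E.q) / (z * (z - 1) * (z - E.t)) * y₀) := by
    unfold op
    field_simp
  rw [e, mul_eq_zero, or_iff_right (mul_ne_zero (mul_ne_zero h0 h1') ht')]

theorem isSolutionOn_iff {U : Set ℂ} {y : ℂ → ℂ} : E.IsSolutionOn U y ↔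
    U ⊆ E.domain ∧ DifferentiableOn ℂ y U ∧
      ∀ z ∈ U, E.op (deriv (deriv y) z) (deriv y z) (y z) z = 0 := by
  unfold IsSolutionOn
  refine and_congr_right fun hU => and_congr_right fun _ => forall₂_congr fun z hz => ?_
  rw [E.op_eq_zero_iff (hU hz)]

/-- The coefficient of `(z - c) ^ j` in the Heun operator applied to `(z - c) ^ (j + 1) * s`,
multiplied by `z - c`, for `c` arbitrary. -/
theorem eventually_op_pow_mul {f s : ℂ → ℂ} {c : ℂ} {j : ℕ} (hs : AnalyticAt ℂ s c)
    (hf : ∀ᶠ z in 𝓝 c, f z = (z - c) ^ (j + 1) * s z) :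
    ∀ᶠ z in 𝓝 c, (z - c) * E.op (deriv (deriv f) z) (deriv f z) (f z) z =
      (z - c) ^ j * E.op ((j + 1) * j * s z
        + 2 * (j + 1) * (z - c) * deriv s z + (z - c) ^ 2 * deriv (deriv s) z)
        ((z - c) * ((j + 1) * s z + (z - c) * deriv s z)) ((z - c) ^ 2 * s z) z := by
  filter_upwards [eventually_deriv_of_eq_pow_mul hs hf, hf] with z hz hz'
  rw [hz.1, hz', op, op]
  linear_combination (z * (z - 1) * (z - E.t)) * hz.2

/-- A nonzero solution with a zero of order `j + 1 ≥ 2` would leave the leading term `(j+1) j c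
(c-1) (c-t) s(c)`, which is nonzero at an ordinary point. -/
theorem eventually_eq_zero_of_jet_eq_zero {y : ℂ → ℂ} {c : ℂ} {U : Set ℂ} (hU : IsOpen U)
    (hc : c ∈ U) (hy : E.IsSolutionOn U y) (h0 : y c = 0) (h1 : deriv y c = 0) :
    ∀ᶠ z in 𝓝 c, y z = 0 := by
  rw [isSolutionOn_iff] at hy
  obtain ⟨hs, hd, he⟩ := hy
  by_contra hne
  have ha : AnalyticAt ℂ y c := hd.analyticAt (hU.mem_nhds hc)
  obtain ⟨n, s, hsa, hsc, hev⟩ := ha.exists_eventuallyEq_pow_smul_nonzero_iff.2 hne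
  simp only [smul_eq_mul] at hev
  have hev0 := hev.self_of_nhds
  cases n with
  | zero => simp [h0, eq_comm, hsc] at hev0
  | succ j =>
    have d1 := (eventually_deriv_of_eq_pow_mul hsa hev).self_of_nhds.1
    have hj : j ≠ 0 := by
      rintro rfl
      simp [h1, eq_comm, hsc] at d1
    have key : E.op ((j + 1) * j * s c
        + 2 * (j + 1) * (c - c) * deriv s c + (c - c) ^ 2 * deriv (deriv s) c)
        ((c - c) * ((j + 1) * s c + (c - c) * deriv s c)) ((c - c) ^ 2 * s c) c = 0 := by
      refine eq_zero_of_continuousAt_of_eventually (c := c)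
        (h := fun z => E.op ((j + 1) * j * s z
          + 2 * (j + 1) * (z - c) * deriv s z + (z - c) ^ 2 * deriv (deriv s) z)
          ((z - c) * ((j + 1) * s z + (z - c) * deriv s z)) ((z - c) ^ 2 * s z) z) ?_ ?_
      · have c0 := hsa.continuousAt
        have c1 := hsa.deriv.continuousAt
        have c2 := hsa.deriv.deriv.continuousAt
        unfold op
        fun_prop
      · filter_upwards [(E.eventually_op_pow_mul hsa hev).filter_mono nhdsWithin_le_nhds,
          nhdsWithin_le_nhds (hU.mem_nhds hc), self_mem_nhdsWithin] with z hz hzU hzc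
        rw [he z hzU, mul_zero, eq_comm, mul_eq_zero] at hz
        exact hz.resolve_left (pow_ne_zero _ (sub_ne_zero.2 hzc))
    obtain ⟨n0, n1, nt⟩ := hs hc
    have hj1 : (j : ℂ) + 1 ≠ 0 := by exact_mod_cast Nat.succ_ne_zero j
    have : (j : ℂ) ≠ 0 := by exact_mod_cast hj
    simp [op, hj1, this, hsc, n0, sub_ne_zero.2 n1, sub_ne_zero.2 nt] at key

theorem eq_zero_of_jet_eq_zero {y : ℂ → ℂ} {c : ℂ} {U : Set ℂ} (hU : IsOpen U)
    (hU' : IsPreconnected U) (hc : c ∈ U) (hy : E.IsSolutionOn U y) (h0 : y c = 0)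
    (h1 : deriv y c = 0) : ∀ z ∈ U, y z = 0 :=
  (hy.2.1.analyticOnNhd hU).eqOn_zero_of_preconnected_of_eventuallyEq_zero hU' hc
    (E.eventually_eq_zero_of_jet_eq_zero hU hc hy h0 h1)

/-- The 1-jet of a function. -/
noncomputable def jet (y : ℂ → ℂ) (z : ℂ) : ℂ × ℂ := (y z, deriv y z)

theorem jet_linComb {U : Set ℂ} (hU : IsOpen U) {y₁ y₂ : ℂ → ℂ} (h₁ : DifferentiableOn ℂ y₁ U)
    (h₂ : DifferentiableOn ℂ y₂ U) (c₁ c₂ : ℂ) {z : ℂ} (hz : z ∈ U) :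
    jet (fun z => c₁ * y₁ z + c₂ * y₂ z) z = c₁ • jet y₁ z + c₂ • jet y₂ z := by
  have a := (h₁.differentiableAt (hU.mem_nhds hz)).hasDerivAt.const_mul c₁
  have b := (h₂.differentiableAt (hU.mem_nhds hz)).hasDerivAt.const_mul c₂
  exact Prod.ext rfl (a.add b).deriv

theorem eqOn_of_jet_eq {y₁ y₂ : ℂ → ℂ} {c : ℂ} {U : Set ℂ} (hU : IsOpen U)
    (hU' : IsPreconnected U) (hc : c ∈ U) (h₁ : E.IsSolutionOn U y₁) (h₂ : E.IsSolutionOn U y₂)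
    (h : jet y₁ c = jet y₂ c) : Set.EqOn y₁ y₂ U := by
  have hj := jet_linComb hU h₁.2.1 h₂.2.1 1 (-1) hc
  have h0 : jet (fun z => 1 * y₁ z + -1 * y₂ z) c = 0 := by rw [hj, h]; simp
  intro z hz
  have := E.eq_zero_of_jet_eq_zero hU hU' hc (IsSolutionOn.linComb E hU h₁ h₂ 1 (-1))
    (congrArg Prod.fst h0) (congrArg Prod.snd h0) z hz
  linear_combination this

theorem jet_congr {y₁ y₂ : ℂ → ℂ} {U : Set ℂ} (hU : IsOpen U) (h : Set.EqOn y₁ y₂ U) {z : ℂ}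
    (hz : z ∈ U) : jet y₁ z = jet y₂ z :=
  Prod.ext (h hz) (h.eventuallyEq_of_mem (hU.mem_nhds hz)).deriv_eq

theorem exists_local_solution {c : ℂ} (hc : c ∈ E.domain) :
    ∃ r : ℝ, 0 < r ∧ Metric.ball c r ⊆ E.domain ∧ ∀ v : ℂ × ℂ, ∃ y : ℂ → ℂ,
      E.IsSolutionOn (Metric.ball c r) y ∧ jet y c = v := by
  obtain ⟨r₁, hr₁, hs⟩ := Metric.isOpen_iff.1 E.isOpen_domain c hc
  obtain ⟨n0, n1, nt⟩ := hc
  -- The arguments are the Taylor coefficients at `c` of the polynomial coefficients of the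
  -- operator.
  obtain ⟨r₂, hr₂, H⟩ := exists_local_solution_zero (c * (c - 1) * (c - E.t))
    ((c - 1) * (c - E.t) + c * (c - E.t) + c * (c - 1)) (c + (c - 1) + (c - E.t)) 1
    (E.γ * ((c - 1) * (c - E.t)) + E.δ * (c * (c - E.t)) + E.ε * (c * (c - 1)))
    (E.γ * ((c - 1) + (c - E.t)) + E.δ * (c + (c - E.t)) + E.ε * (c + (c - 1)))
    (E.γ + E.δ + E.ε) (E.α * E.β * c - E.q) (E.α * E.β)
    (mul_ne_zero (mul_ne_zero n0 (sub_ne_zero.2 n1)) (sub_ne_zero.2 nt))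
  have hsub : Metric.ball c (min r₁ r₂) ⊆ E.domain :=
    (Metric.ball_subset_ball (min_le_left _ _)).trans hs
  refine ⟨min r₁ r₂, lt_min hr₁ hr₂, hsub, fun v => ?_⟩
  obtain ⟨f, hd, f0, f1, hf⟩ := H v.1 v.2
  have hd1 : deriv (fun z => f (z - c)) = fun z => deriv f (z - c) := by
    ext z
    exact deriv_comp_sub_const f c z
  have hd2 : deriv (deriv fun z => f (z - c)) = fun z => deriv (deriv f) (z - c) := by
    rw [hd1]
    ext z
    exact deriv_comp_sub_const (deriv f) c z
  have hm : ∀ z ∈ Metric.ball c (min r₁ r₂), z - c ∈ Metric.ball (0 : ℂ) r₂ := by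
    intro z hz
    rw [Metric.mem_ball, dist_eq_norm] at hz
    rw [mem_ball_zero_iff]
    exact hz.trans_le (min_le_right _ _)
  refine ⟨fun z => f (z - c), E.isSolutionOn_iff.2 ⟨hsub, ?_, ?_⟩, ?_⟩
  · exact hd.comp (by fun_prop) hm
  · intro z hz
    rw [hd2, hd1, op]
    linear_combination hf (z - c) (hm z hz)
  · rw [jet, hd1]
    simp [f0, f1]

end HeunEquation

end LocalTheory

/-! ### The Heun operator on polynomials and Lagrange's identity. -/

section PolynomialSolutions

namespace HeunEquation

variable (E : HeunEquation)

/-- The Heun operator on polynomials. -/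
noncomputable def polyOp : ℂ[X] →ₗ[ℂ] ℂ[X] where
  toFun p := X * (X - 1) * (X - C E.t) * derivative (derivative p)
    + (C E.γ * ((X - 1) * (X - C E.t)) + C E.δ * (X * (X - C E.t)) + C E.ε * (X * (X - 1)))
      * derivative p + (C (E.α * E.β) * X - C E.q) * p
  map_add' p₁ p₂ := by simp only [derivative_add]; ring
  map_smul' c p := by
    simp only [smul_eq_C_mul, derivative_C_mul, RingHom.id_apply]
    ring

theorem polyOp_apply (p : ℂ[X]) : E.polyOp p =
    X * (X - 1) * (X - C E.t) * derivative (derivative p)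
    + (C E.γ * ((X - 1) * (X - C E.t)) + C E.δ * (X * (X - C E.t)) + C E.ε * (X * (X - 1)))
      * derivative p + (C (E.α * E.β) * X - C E.q) * p := rfl

theorem eval_polyOp (p : ℂ[X]) (z : ℂ) : (E.polyOp p).eval z =
    E.op (deriv (deriv fun w => p.eval w) z) (deriv (fun w => p.eval w) z) (p.eval z) z := by
  have h1 : deriv (fun w => p.eval w) = fun w => (derivative p).eval w := funext fun w => p.deriv
  rw [h1, (derivative p).deriv, polyOp_apply, op]
  simp

/-- By the Fuchs relation the top coefficient is multiplied by `k(k-1) + (α+β+1)k + αβ`, the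
indicial polynomial at infinity. -/
theorem coeff_polyOp_succ (p : ℂ[X]) (k : ℕ) (hp : p.natDegree ≤ k) :
    (E.polyOp p).coeff (k + 1) = (k + E.α) * (k + E.β) * p.coeff k := by
  have e : E.polyOp p = X * (X * (X * derivative (derivative p)))
      - C (1 + E.t) * (X * (X * derivative (derivative p)))
      + C E.t * (X * derivative (derivative p))
      + C (E.α + E.β + 1) * (X * (X * derivative p))
      - C (E.γ * (1 + E.t) + E.δ * E.t + E.ε) * (X * derivative p) + C (E.γ * E.t) * derivative p
      + C (E.α * E.β) * (X * p) - C E.q * p := by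
    rw [← E.fuchs, polyOp_apply]
    simp only [map_add, map_mul, map_one]
    ring
  have h0 : ∀ j, k < j → p.coeff j = 0 := fun j hj =>
    coeff_eq_zero_of_natDegree_lt (hp.trans_lt hj)
  rw [e]
  simp only [coeff_add, coeff_sub, coeff_C_mul]
  rcases k with _ | _ | k
  · simp [coeff_derivative, h0]
  · simp [coeff_X_mul, coeff_derivative, h0]
    ring
  · simp [coeff_X_mul, coeff_derivative, h0]
    ring

/-- The product in `hk` covers both uses: `-k` is `α` or `β`, or the coefficient of degree `k`
vanishes. -/
theorem degree_polyOp_lt (p : ℂ[X]) (k : ℕ) (hp : p.natDegree ≤ k)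
    (hk : (k + E.α) * (k + E.β) * p.coeff k = 0) : (E.polyOp p).degree < (k + 1 : ℕ) := by
  rw [degree_lt_iff_coeff_zero]
  intro m hm
  obtain ⟨j, rfl⟩ : ∃ j, m = j + 1 := ⟨m - 1, by omega⟩
  rw [E.coeff_polyOp_succ p j (hp.trans (by omega))]
  rcases (Nat.le_of_succ_le_succ hm).eq_or_lt with rfl | hj
  · exact hk
  · rw [coeff_eq_zero_of_natDegree_lt (hp.trans_lt hj), mul_zero]

/-- If the exponent at infinity allows it, there is a nonzero polynomial solution of degree at
most `k` or the inhomogeneous equation with right hand side `1` has a polynomial solution. -/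
theorem exists_polyOp_eq_zero_or_one (k : ℕ) (hk : ((k : ℂ) + E.α) * (k + E.β) = 0) :
    (∃ p : ℂ[X], p ≠ 0 ∧ E.polyOp p = 0) ∨ ∃ p : ℂ[X], E.polyOp p = 1 := by
  -- Polynomials of degree at most `k` form a finite-dimensional stable space, on which injectivity
  -- implies surjectivity.
  have hmap : ∀ p ∈ degreeLT ℂ (k + 1), E.polyOp p ∈ degreeLT ℂ (k + 1) := by
    intro p hp
    rw [mem_degreeLT] at hp ⊢
    refine E.degree_polyOp_lt p k ?_ (by rw [hk, zero_mul])
    rcases eq_or_ne p 0 with rfl | h0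
    · simp
    · exact Nat.lt_succ_iff.1 ((natDegree_lt_iff_degree_lt h0).2 hp)
  let T := E.polyOp.restrict hmap
  by_cases hT : Function.Injective T
  · right
    have hs : Function.Surjective T := LinearMap.injective_iff_surjective.1 hT
    obtain ⟨p, hp⟩ := hs ⟨1, by rw [mem_degreeLT, degree_one]; exact_mod_cast k.succ_pos⟩
    exact ⟨p, congrArg Subtype.val hp⟩
  · left
    rw [← LinearMap.ker_eq_bot, Submodule.eq_bot_iff] at hT
    push Not at hT
    obtain ⟨p, hp, hp0⟩ := hT
    exact ⟨p, fun h => hp0 (Subtype.ext h), congrArg Subtype.val hp⟩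

/-- The Heun equation satisfied by `φ⁻¹ y` where `y` is a solution and
`φ = z ^ a (z - 1) ^ b (z - t) ^ c` with exponents `a, b, c` at `0, 1, t`. -/
def gauge (a b c : ℂ) : HeunEquation where
  α := E.α + (a + b + c)
  β := E.β + (a + b + c)
  γ := E.γ + 2 * a
  δ := E.δ + 2 * b
  ε := E.ε + 2 * c
  q := E.q + (2 * a * b + E.γ * b + E.δ * a) * E.t + (2 * a * c + E.γ * c + E.ε * a)
  t := E.t
  t_ne_zero := E.t_ne_zero
  t_ne_one := E.t_ne_one
  fuchs := by linear_combination E.fuchs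

/-- Lagrange's identity between the Heun operator and its conjugate by
`z ^ (1 - γ) (z - 1) ^ (1 - δ)`. -/
theorem lagrange (p h : ℂ[X]) :
    h * E.polyOp p - p * (E.gauge (1 - E.γ) (1 - E.δ) 0).polyOp h =
      (X - C E.t) * derivative (X * (X - 1) * (derivative p * h - p * derivative h)
        - (C (1 - E.γ) * (X - 1) + C (1 - E.δ) * X) * (p * h))
      + C E.ε * (X * (X - 1) * (derivative p * h - p * derivative h)
        - (C (1 - E.γ) * (X - 1) + C (1 - E.δ) * X) * (p * h)) := by
  have hβ : E.β = E.γ + E.δ + E.ε - E.α - 1 := by linear_combination -E.fuchs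
  simp only [polyOp_apply, gauge, derivative_mul, derivative_X, derivative_C, derivative_one,
    map_add, map_mul, map_sub, hβ, map_one, map_zero, C_ofNat]
  ring

/-- The coefficient of `(X - t) ^ N` in a right hand side of Lagrange's identity vanishes. -/
theorem coeff_taylor_lagrange (t : ℂ) (N : ℕ) (B : ℂ[X]) :
    (taylor t ((X - C t) * derivative B + C (-(N : ℂ)) * B)).coeff N = 0 := by
  have hX : taylor t (X - C t) = X := by simp
  have hd : taylor t (derivative B) = derivative (taylor t B) := by
    simp only [taylor_apply, derivative_comp, derivative_add, derivative_X, derivative_C, add_zero,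
      one_mul]
  rw [map_add, taylor_mul, taylor_mul, hX, hd, taylor_C, coeff_add, coeff_C_mul]
  cases N with
  | zero => simp
  | succ N =>
    rw [coeff_X_mul, coeff_derivative]
    push_cast
    ring

/-- Translation of the variable preserves the leading coefficient. -/
theorem coeff_eq_zero_of_taylor {t : ℂ} {N : ℕ} {h : ℂ[X]} (hd : h.natDegree ≤ N)
    (h0 : (taylor t h).coeff N = 0) : h.coeff N = 0 := by
  rcases hd.lt_or_eq with hlt | rfl
  · exact coeff_eq_zero_of_natDegree_lt hlt
  · have := leadingCoeff_taylor t h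
    rw [leadingCoeff, natDegree_taylor] at this
    rw [← h0, this, leadingCoeff]

theorem coeff_taylor_of_dvd {t : ℂ} {N : ℕ} {f : ℂ[X]} (h : (X - C t) ^ (N + 1) ∣ f) :
    (taylor t f).coeff N = 0 := by
  obtain ⟨g, rfl⟩ := h
  have hX : taylor t (X - C t) = X := by simp
  rw [taylor_mul, taylor_pow, hX, coeff_X_pow_mul', if_neg (by omega)]

/-- A polynomial of degree at most `N` whose image is divisible by `(X - t) ^ (N + 1)` is a
solution as soon as its coefficient of degree `N` vanishes. -/
theorem polyOp_eq_zero_of_dvd {N : ℕ} {t : ℂ} {g : ℂ[X]} (hd : g.natDegree ≤ N)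
    (hg : (X - C t) ^ (N + 1) ∣ E.polyOp g) (h0 : g.coeff N = 0) : E.polyOp g = 0 := by
  refine eq_zero_of_dvd_of_degree_lt hg ?_
  rw [degree_pow, degree_X_sub_C, nsmul_one]
  exact_mod_cast E.degree_polyOp_lt g N hd (by rw [h0, mul_zero])

/-- The algebraic core: if `ε = -N` and both the equation and its conjugate have a solution modulo
`(X - t) ^ (N + 1)`, then for integral `α` one of the two has a nonzero polynomial solution. -/
theorem exists_polynomial_solution {N : ℕ} {m : ℤ} (hα : E.α = m) (hε : E.ε = -(N : ℂ))
    {g h : ℂ[X]} (hg0 : g ≠ 0) (hh0 : h ≠ 0) (hgd : g.natDegree ≤ N) (hhd : h.natDegree ≤ N)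
    (hg : (X - C E.t) ^ (N + 1) ∣ E.polyOp g)
    (hh : (X - C E.t) ^ (N + 1) ∣ (E.gauge (1 - E.γ) (1 - E.δ) 0).polyOp h) :
    (∃ p : ℂ[X], p ≠ 0 ∧ E.polyOp p = 0) ∨
      ∃ p : ℂ[X], p ≠ 0 ∧ (E.gauge (1 - E.γ) (1 - E.δ) 0).polyOp p = 0 := by
  have hlag : ∀ p h : ℂ[X], (taylor E.t (h * E.polyOp p)).coeff N =
      (taylor E.t (p * (E.gauge (1 - E.γ) (1 - E.δ) 0).polyOp h)).coeff N := by
    intro p h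
    rw [← sub_eq_zero, ← coeff_sub, ← map_sub, E.lagrange p h, hε, coeff_taylor_lagrange]
  rcases le_or_gt m 0 with hm | hm
  · obtain ⟨k, rfl⟩ := Int.exists_eq_neg_ofNat hm
    rcases E.exists_polyOp_eq_zero_or_one k (by rw [hα]; simp) with hp | ⟨p, hp⟩
    · exact Or.inl hp
    · refine Or.inr ⟨h, hh0, polyOp_eq_zero_of_dvd _ hhd hh (coeff_eq_zero_of_taylor (t := E.t) hhd ?_)⟩
      have := hlag p h
      rw [hp, mul_one] at this
      rw [this]
      exact coeff_taylor_of_dvd (hh.mul_left p)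
  · obtain ⟨k, rfl⟩ : ∃ k : ℕ, m = k + 1 := ⟨(m - 1).toNat, by omega⟩
    -- One exponent parameter of the conjugate at infinity is `β + 2 - γ - δ = 1 - α + ε = -(k +
    -- N)`.
    rcases (E.gauge (1 - E.γ) (1 - E.δ) 0).exists_polyOp_eq_zero_or_one (k + N) (by
      simp only [gauge]
      have := E.fuchs
      rw [hε, hα] at this
      push_cast at this ⊢
      rw [show (k : ℂ) + N + (E.β + (1 - E.γ + (1 - E.δ) + 0)) = 0 by linear_combination -this,
        mul_zero]) with hp | ⟨p, hp⟩
    · exact Or.inr hp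
    · refine Or.inl ⟨g, hg0, polyOp_eq_zero_of_dvd _ hgd hg (coeff_eq_zero_of_taylor (t := E.t) hgd ?_)⟩
      have := hlag g p
      rw [hp, mul_one] at this
      rw [← this]
      exact coeff_taylor_of_dvd (hg.mul_left p)

end HeunEquation

end PolynomialSolutions

/-! ### From an apparent singularity to an elementary solution. -/

section Apparent

open Filter

theorem AnalyticAt.exists_taylor_polynomial {c : ℂ} (n : ℕ) {f : ℂ → ℂ} (hf : AnalyticAt ℂ f c) :
    ∃ g : ℂ[X], g.natDegree ≤ n ∧ g.eval c = f c ∧ ∃ s : ℂ → ℂ, AnalyticAt ℂ s c ∧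
      ∀ z, f z = g.eval z + (z - c) ^ (n + 1) * s z := by
  induction n generalizing f with
  | zero =>
    obtain ⟨P, hP⟩ := hf
    refine ⟨C (f c), by simp, by simp, dslope f c, ⟨_, hP.has_fpower_series_dslope_fslope⟩,
      fun z => ?_⟩
    have := sub_smul_dslope f c z
    rw [smul_eq_mul] at this
    simp [this]
  | succ n ih =>
    obtain ⟨P, hP⟩ := hf
    obtain ⟨g, hd, -, s, hs, he⟩ := ih (f := dslope f c) ⟨_, hP.has_fpower_series_dslope_fslope⟩
    refine ⟨C (f c) + (X - C c) * g, ?_, by simp, s, hs, fun z => ?_⟩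
    · refine (natDegree_add_le _ _).trans (max_le (by simp) ?_)
      refine natDegree_mul_le.trans ?_
      rw [natDegree_X_sub_C]
      omega
    · have := sub_smul_dslope f c z
      rw [smul_eq_mul, he z] at this
      simp only [eval_add, eval_C, eval_mul, eval_sub, eval_X]
      linear_combination -this

/-- If the multiplicity of `c` were below `n`, cancelling it and letting `z → c` would make the
cofactor vanish at `c`. -/
theorem Polynomial.X_sub_C_pow_dvd_of_eventually {c : ℂ} {n : ℕ} {f : ℂ[X]} {A : ℂ → ℂ}
    (hA : ContinuousAt A c) (h : ∀ᶠ z in 𝓝[≠] c, f.eval z = (z - c) ^ n * A z) :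
    (X - C c) ^ n ∣ f := by
  by_cases hf : f = 0
  · simp [hf]
  obtain ⟨g, hg, hgc⟩ := exists_eq_pow_rootMultiplicity_mul_and_not_dvd f hf c
  refine (le_rootMultiplicity_iff hf).1 ?_
  by_contra! hlt
  obtain ⟨k, hk⟩ := Nat.exists_eq_add_of_lt hlt
  apply hgc
  rw [dvd_iff_isRoot, IsRoot.def]
  have := eq_zero_of_continuousAt_of_eventually (c := c)
    (h := fun z => g.eval z - (z - c) ^ (k + 1) * A z) (by fun_prop) (by
      filter_upwards [h, self_mem_nhdsWithin] with z hz hzc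
      have hp : (z - c) ^ rootMultiplicity c f ≠ 0 := pow_ne_zero _ (sub_ne_zero.2 hzc)
      apply mul_left_cancel₀ hp
      rw [hg, eval_mul, eval_pow, eval_sub, eval_X, eval_C, hk] at hz
      linear_combination hz)
  simpa using this

theorem exists_exp_primitive {c : ℂ} {r : ℝ} {ρ : ℂ → ℂ}
    (hρ : DifferentiableOn ℂ ρ (Metric.ball c r)) : ∃ φ : ℂ → ℂ,
      ∀ z ∈ Metric.ball c r, HasDerivAt φ (ρ z * φ z) z ∧ φ z ≠ 0 := by
  obtain ⟨g, hg⟩ := hρ.isExactOn_ball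
  refine ⟨fun z => Complex.exp (g z), fun z hz => ⟨?_, Complex.exp_ne_zero _⟩⟩
  simpa [mul_comm] using (hg z hz).cexp

namespace HeunEquation

variable (E : HeunEquation)

theorem IsSolutionOn.congr {U : Set ℂ} (hU : IsOpen U) {y₁ y₂ : ℂ → ℂ} (h : Set.EqOn y₂ y₁ U)
    (hy : E.IsSolutionOn U y₁) : E.IsSolutionOn U y₂ := by
  have h' : Set.EqOn (deriv y₂) (deriv y₁) U := h.deriv hU
  refine ⟨hy.1, hy.2.1.congr h, fun z hz => ?_⟩
  rw [h'.deriv hU hz, h' hz, h hz]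
  exact hy.2.2 z hz

/-- The logarithmic derivative of `z ^ a (z - 1) ^ b (z - t) ^ c`. -/
noncomputable def logDer (a b c z : ℂ) : ℂ := a / z + b / (z - 1) + c / (z - E.t)

theorem hasDerivAt_logDer (a b c : ℂ) {z : ℂ} (hz : z ∈ E.domain) :
    HasDerivAt (E.logDer a b c)
      (-(a / z ^ 2) - b / (z - 1) ^ 2 - c / (z - E.t) ^ 2) z := by
  obtain ⟨h0, h1, ht⟩ := hz
  have key : ∀ k x : ℂ, z - x ≠ 0 → HasDerivAt (fun z => k / (z - x)) (-(k / (z - x) ^ 2)) z := by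
    intro k x hx
    have := ((((hasDerivAt_id z).sub_const x).fun_inv hx).const_mul k)
    refine (this.congr_deriv ?_).congr_of_eventuallyEq (Eventually.of_forall fun w => ?_)
    · simp [div_eq_mul_inv]
    · simp [div_eq_mul_inv]
  have k0 := key a 0 (by simpa using h0)
  simp only [sub_zero] at k0
  exact ((k0.add (key b 1 (sub_ne_zero.2 h1))).add (key c E.t (sub_ne_zero.2 ht))).congr_deriv
    (by ring)

theorem op_gauge {a b c : ℂ} (ha : a * (a - 1 + E.γ) = 0) (hb : b * (b - 1 + E.δ) = 0)
    (hc : c * (c - 1 + E.ε) = 0) {z : ℂ} (hz : z ∈ E.domain) (w₂ w₁ w₀ : ℂ) :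
    E.op ((-(a / z ^ 2) - b / (z - 1) ^ 2 - c / (z - E.t) ^ 2) * w₀ + E.logDer a b c z ^ 2 * w₀
        + 2 * E.logDer a b c z * w₁ + w₂) (E.logDer a b c z * w₀ + w₁) w₀ z =
      (E.gauge a b c).op w₂ w₁ w₀ z := by
  obtain ⟨h0, h1, ht⟩ := hz
  have h1' := sub_ne_zero.2 h1
  have ht' := sub_ne_zero.2 ht
  have hβ : E.β = E.γ + E.δ + E.ε - E.α - 1 := by linear_combination -E.fuchs
  rw [← sub_eq_zero]
  -- In each cofactor the fraction comes from a double pole created by the conjugation, and `-z`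
  -- from the term such as `a (a - 1 + γ) z` in the new `αβz`.
  have e : ∀ x : ℂ, x = (a * (a - 1 + E.γ)) * (((z - 1) * (z - E.t) / z - z) * w₀)
      + (b * (b - 1 + E.δ)) * ((z * (z - E.t) / (z - 1) - z) * w₀)
      + (c * (c - 1 + E.ε)) * ((z * (z - 1) / (z - E.t) - z) * w₀) → x = 0 := by
    intro x h
    rw [h, ha, hb, hc]
    ring
  refine e _ ?_
  simp only [op, gauge, logDer, hβ]
  field_simp
  ring

theorem isSolutionOn_gauge_iff {a b c : ℂ} (ha : a * (a - 1 + E.γ) = 0)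
    (hb : b * (b - 1 + E.δ) = 0) (hc : c * (c - 1 + E.ε) = 0) {U : Set ℂ} (hU : IsOpen U)
    (hUd : U ⊆ E.domain) {φ w : ℂ → ℂ} (hφ : ∀ z ∈ U, HasDerivAt φ (E.logDer a b c z * φ z) z)
    (hφ0 : ∀ z ∈ U, φ z ≠ 0) (hw : DifferentiableOn ℂ w U) :
    E.IsSolutionOn U (fun z => φ z * w z) ↔ (E.gauge a b c).IsSolutionOn U w := by
  have hφd : DifferentiableOn ℂ φ U := fun z hz => (hφ z hz).differentiableAt.differentiableWithinAt
  have d1 : Set.EqOn (deriv fun z => φ z * w z)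
      (fun z => φ z * (E.logDer a b c z * w z + deriv w z)) U := by
    intro z hz
    have := ((hφ z hz).mul (hw.differentiableAt (hU.mem_nhds hz)).hasDerivAt).deriv
    refine this.trans ?_
    ring
  have key : ∀ z ∈ U, E.op (deriv (deriv fun z => φ z * w z) z) (deriv (fun z => φ z * w z) z)
      (φ z * w z) z = φ z * (E.gauge a b c).op (deriv (deriv w) z) (deriv w z) (w z) z := by
    intro z hz
    have hwz := (hw.differentiableAt (hU.mem_nhds hz)).hasDerivAt
    have hwz' := ((hw.deriv hU).differentiableAt (hU.mem_nhds hz)).hasDerivAt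
    have d2 := ((hφ z hz).mul (((E.hasDerivAt_logDer a b c (hUd hz)).mul hwz).add hwz')).deriv
    have d2' : deriv (deriv fun z => φ z * w z) z = _ := (d1.deriv hU hz).trans d2
    rw [d2', d1 hz, ← E.op_gauge ha hb hc (hUd hz)]
    simp only [op, Pi.add_apply, Pi.mul_apply]
    ring
  rw [isSolutionOn_iff, isSolutionOn_iff]
  refine and_congr_right fun _ => and_congr ⟨fun _ => hw, fun _ => hφd.mul hw⟩
    (forall₂_congr fun z hz => ?_)
  rw [key z hz, mul_eq_zero, or_iff_right (hφ0 z hz)]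

/-- The Heun operator near `t` on functions vanishing there: the indicial polynomial at `t`. -/
theorem exists_op_eq_pow_mul {f s : ℂ → ℂ} {j : ℕ} (hs : AnalyticAt ℂ s E.t)
    (hf : ∀ᶠ z in 𝓝 E.t, f z = (z - E.t) ^ (j + 1) * s z) :
    ∃ A : ℂ → ℂ, ContinuousAt A E.t ∧ ∀ᶠ z in 𝓝[≠] E.t,
      E.op (deriv (deriv f) z) (deriv f z) (f z) z =
        (z - E.t) ^ j * ((j + 1) * (j + E.ε) * (z * (z - 1)) * s z + (z - E.t) * A z) := by
  have c0 := hs.continuousAt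
  have c1 := hs.deriv.continuousAt
  have c2 := hs.deriv.deriv.continuousAt
  refine ⟨fun z => z * (z - 1) * (2 * (j + 1) * deriv s z + (z - E.t) * deriv (deriv s) z)
    + (E.γ * (z - 1) + E.δ * z) * ((j + 1) * s z + (z - E.t) * deriv s z)
    + E.ε * (z * (z - 1)) * deriv s z + (E.α * E.β * z - E.q) * s z, by fun_prop, ?_⟩
  filter_upwards [(E.eventually_op_pow_mul hs hf).filter_mono nhdsWithin_le_nhds,
    self_mem_nhdsWithin] with z hz hzt
  apply mul_left_cancel₀ (sub_ne_zero.2 hzt)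
  rw [hz]
  simp only [op]
  ring

/-- If `ε = 1`, a holomorphic solution near `t` which vanishes at `t` is zero. -/
theorem eventually_eq_zero_of_eps_eq_one (hε : E.ε = 1) {w : ℂ → ℂ} (hw : AnalyticAt ℂ w E.t)
    (h0 : w E.t = 0)
    (hop : ∀ᶠ z in 𝓝[≠] E.t, E.op (deriv (deriv w) z) (deriv w z) (w z) z = 0) :
    ∀ᶠ z in 𝓝 E.t, w z = 0 := by
  by_contra hne
  obtain ⟨n, s, hsa, hsc, hev⟩ := hw.exists_eventuallyEq_pow_smul_nonzero_iff.2 hne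
  simp only [smul_eq_mul] at hev
  cases n with
  | zero =>
    have := hev.self_of_nhds
    simp [h0, eq_comm, hsc] at this
  | succ j =>
    obtain ⟨A, hA, he⟩ := E.exists_op_eq_pow_mul hsa hev
    have c0 := hsa.continuousAt
    have key := eq_zero_of_continuousAt_of_eventually (c := E.t)
      (h := fun z => (j + 1) * (j + E.ε) * (z * (z - 1)) * s z + (z - E.t) * A z) (by fun_prop) (by
        filter_upwards [he, hop, self_mem_nhdsWithin] with z hz hz' hzt
        rw [hz', eq_comm, mul_eq_zero] at hz
        exact hz.resolve_left (pow_ne_zero _ (sub_ne_zero.2 hzt)))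
    have hj1 : (j : ℂ) + 1 ≠ 0 := by exact_mod_cast Nat.succ_ne_zero j
    simp [hε, hj1, hsc, E.t_ne_zero, sub_ne_zero.2 E.t_ne_one] at key

/-- `N + 1 = 1 - ε` is an exponent at `t`, so the operator sends the remainder `(z-t)^(N+1) s` to
order `N + 1` instead of `N`; as it kills `u`, the Taylor polynomial inherits this order. -/
theorem exists_truncated_solution {N : ℕ} (hε : E.ε = -(N : ℂ)) {u : ℂ → ℂ}
    (hu : AnalyticAt ℂ u E.t) (h0 : u E.t ≠ 0)
    (hop : ∀ᶠ z in 𝓝[≠] E.t, E.op (deriv (deriv u) z) (deriv u z) (u z) z = 0) :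
    ∃ g : ℂ[X], g ≠ 0 ∧ g.natDegree ≤ N ∧ (X - C E.t) ^ (N + 1) ∣ E.polyOp g := by
  obtain ⟨g, hd, hg0, s, hs, he⟩ := hu.exists_taylor_polynomial N
  refine ⟨g, ?_, hd, ?_⟩
  · rintro rfl
    simp [eq_comm, h0] at hg0
  have hf : ∀ᶠ z in 𝓝 E.t, u z - g.eval z = (z - E.t) ^ (N + 1) * s z :=
    Eventually.of_forall fun z => by rw [he z]; ring
  obtain ⟨A, hA, hev⟩ := E.exists_op_eq_pow_mul (f := fun z => u z - g.eval z) hs hf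
  refine X_sub_C_pow_dvd_of_eventually (A := fun z => -A z) hA.neg ?_
  filter_upwards [hev, hop, (hu.eventually_analyticAt).filter_mono nhdsWithin_le_nhds,
    (hu.deriv.eventually_analyticAt).filter_mono nhdsWithin_le_nhds,
    (hu.eventually_analyticAt.eventually_nhds).filter_mono nhdsWithin_le_nhds]
    with z hz hz' hu0 hu1 hun
  have d1 : deriv (fun z => u z - g.eval z) =ᶠ[𝓝 z]
      fun z => deriv u z - deriv (fun z => g.eval z) z := by
    filter_upwards [hun] with w hw
    exact (hw.differentiableAt.hasDerivAt.sub g.differentiableAt.hasDerivAt).deriv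
  have hg' : deriv (fun z => g.eval z) = fun z => (derivative g).eval z :=
    funext fun z => g.deriv
  have d2 : deriv (deriv (fun z => u z - g.eval z)) z =
      deriv (deriv u) z - deriv (deriv fun z => g.eval z) z := by
    rw [d1.deriv_eq, hg']
    exact (hu1.differentiableAt.hasDerivAt.sub (derivative g).differentiableAt.hasDerivAt).deriv
  rw [d2, d1.self_of_nhds] at hz
  rw [eval_polyOp]
  simp only [hε, op] at hz hz' ⊢
  linear_combination hz' - hz

/-- The equation has a solution `z ^ a (z - 1) ^ b (z - t) ^ c p(z)` with a nonzero polynomial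
`p`, in terms of arbitrary local branches `φ` of the first factor. -/
def HasElementarySolution : Prop :=
  ∃ a b c : ℂ, ∃ p : ℂ[X], p ≠ 0 ∧ ∀ U : Set ℂ, IsOpen U → U ⊆ E.domain → ∀ φ : ℂ → ℂ,
    (∀ z ∈ U, HasDerivAt φ (E.logDer a b c z * φ z) z) → (∀ z ∈ U, φ z ≠ 0) →
    E.IsSolutionOn U (fun z => φ z * p.eval z)

theorem hasElementarySolution_of_polyOp_gauge {a b c : ℂ} (ha : a * (a - 1 + E.γ) = 0)
    (hb : b * (b - 1 + E.δ) = 0) (hc : c * (c - 1 + E.ε) = 0) {p : ℂ[X]} (hp : p ≠ 0)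
    (h : (E.gauge a b c).polyOp p = 0) : E.HasElementarySolution := by
  refine ⟨a, b, c, p, hp, fun U hU hUd φ hφ hφ0 => ?_⟩
  rw [E.isSolutionOn_gauge_iff ha hb hc hU hUd hφ hφ0 p.differentiable.differentiableOn,
    isSolutionOn_iff]
  refine ⟨hUd, p.differentiable.differentiableOn, fun z _ => ?_⟩
  rw [← eval_polyOp, h, eval_zero]

theorem gauge_zero : E.gauge 0 0 0 = E := by
  cases E
  simp [gauge]

theorem HasElementarySolution.of_gauge {k : ℤ} (hk : (k : ℂ) * (k - 1 + E.ε) = 0)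
    (h : (E.gauge 0 0 k).HasElementarySolution) : E.HasElementarySolution := by
  obtain ⟨a, b, c, p, hp, H⟩ := h
  refine ⟨a, b, c + k, p, hp, fun U hU hUd φ hφ hφ0 => ?_⟩
  have hzp : ∀ (l : ℤ), ∀ z ∈ U, HasDerivAt (fun z => (z - E.t) ^ l)
      (l / (z - E.t) * (z - E.t) ^ l) z := by
    intro l z hz
    have ht := sub_ne_zero.2 (hUd hz).2.2
    have := (hasDerivAt_zpow l (z - E.t) (Or.inl ht)).comp z ((hasDerivAt_id z).sub_const E.t)
    refine this.congr_deriv ?_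
    rw [zpow_sub_one₀ ht]
    ring
  have hne : ∀ (l : ℤ), ∀ z ∈ U, (z - E.t) ^ l ≠ 0 := fun l z hz =>
    zpow_ne_zero l (sub_ne_zero.2 (hUd hz).2.2)
  -- An integral power of `z - t` is single-valued, so dividing `φ` by it gives a branch with
  -- exponents `a, b, c` on all of `U`.
  have h2 := H U hU hUd (fun z => φ z * (z - E.t) ^ (-k)) (fun z hz => by
    refine ((hφ z hz).mul (hzp (-k) z hz)).congr_deriv ?_
    simp only [logDer, gauge]
    push_cast
    ring) (fun z hz => mul_ne_zero (hφ0 z hz) (hne _ z hz))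
  have h3 := (E.isSolutionOn_gauge_iff (a := 0) (b := 0) (by simp) (by simp) hk hU hUd
    (φ := fun z => (z - E.t) ^ k) (fun z hz => (hzp k z hz).congr_deriv (by simp [logDer]))
    (hne k) h2.2.1).2 h2
  refine h3.congr E hU fun z hz => ?_
  have : (z - E.t) ^ k * (z - E.t) ^ (-k) = 1 := by
    rw [← zpow_add₀ (sub_ne_zero.2 (hUd hz).2.2), add_neg_cancel, zpow_zero]
  linear_combination (-(φ z * p.eval z)) * this

/-- A holomorphic solution near `t` with nonzero value at `t` gives, for `ε = -N` and integral
`α`, an elementary solution. -/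
theorem hasElementarySolution_of_eps_nonpos {N : ℕ} {m : ℤ} (hα : E.α = m) (hε : E.ε = -(N : ℂ))
    {r : ℝ} (hr : 0 < r) {u : ℂ → ℂ} (hu : DifferentiableOn ℂ u (Metric.ball E.t r))
    (h0 : u E.t ≠ 0) (hsol : E.IsSolutionOn (Metric.ball E.t r \ {E.t}) u) :
    E.HasElementarySolution := by
  have hmem := Metric.ball_mem_nhds E.t hr
  have hUo : IsOpen (Metric.ball E.t r \ {E.t}) := Metric.isOpen_ball.sdiff isClosed_singleton
  have hUn : Metric.ball E.t r \ {E.t} ∈ 𝓝[≠] E.t :=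
    inter_mem (nhdsWithin_le_nhds hmem) self_mem_nhdsWithin
  obtain ⟨g, hg0, hgd, hg⟩ := E.exists_truncated_solution hε (hu.analyticAt hmem) h0
    (by filter_upwards [hUn] with z hz using (E.isSolutionOn_iff.1 hsol).2.2 z hz)
  have hball : Metric.ball E.t r ⊆ {z | z ≠ 0 ∧ z - 1 ≠ 0} := by
    intro z hz
    rcases eq_or_ne z E.t with rfl | hne
    · exact ⟨E.t_ne_zero, sub_ne_zero.2 E.t_ne_one⟩
    · have := hsol.1 ⟨hz, hne⟩
      exact ⟨this.1, sub_ne_zero.2 this.2.1⟩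
  -- A branch of `z^(1-γ) (z-1)^(1-δ)` exists on the full disc, including `t`, so `φ⁻¹ u` remains
  -- holomorphic and nonzero there.
  obtain ⟨φ, hφ⟩ := exists_exp_primitive (c := E.t) (r := r)
    (ρ := E.logDer (1 - E.γ) (1 - E.δ) 0) (by
      intro z hz
      obtain ⟨z0, z1⟩ := hball hz
      unfold logDer
      simp only [zero_div, add_zero]
      exact DifferentiableAt.differentiableWithinAt (by fun_prop (disch := assumption)))
  have hφd : DifferentiableOn ℂ φ (Metric.ball E.t r) := fun z hz =>
    (hφ z hz).1.differentiableAt.differentiableWithinAt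
  have hud : DifferentiableOn ℂ (fun z => (φ z)⁻¹ * u z) (Metric.ball E.t r) :=
    (hφd.inv fun z hz => (hφ z hz).2).mul hu
  have ha : (1 - E.γ) * (1 - E.γ - 1 + E.γ) = 0 := by ring
  have hb : (1 - E.δ) * (1 - E.δ - 1 + E.δ) = 0 := by ring
  have hc : (0 : ℂ) * (0 - 1 + E.ε) = 0 := by ring
  have hsol' := (E.isSolutionOn_gauge_iff ha hb hc hUo hsol.1 (fun z hz => (hφ z hz.1).1)
    (fun z hz => (hφ z hz.1).2) (hud.mono Set.sdiff_subset)).1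
    (hsol.congr E hUo fun z hz => by
      have := (hφ z hz.1).2
      field_simp)
  obtain ⟨h, hh0, hhd, hh⟩ := (E.gauge (1 - E.γ) (1 - E.δ) 0).exists_truncated_solution (N := N)
    (by simp [gauge, hε]) (hud.analyticAt hmem)
    (mul_ne_zero (inv_ne_zero (hφ E.t (Metric.mem_ball_self hr)).2) h0)
    (by filter_upwards [hUn] with z hz using (isSolutionOn_iff _).1 hsol' |>.2.2 z hz)
  rcases E.exists_polynomial_solution hα hε hg0 hh0 hgd hhd hg hh with ⟨p, hp, h⟩ | ⟨p, hp, h⟩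
  · exact E.hasElementarySolution_of_polyOp_gauge (a := 0) (b := 0) (c := 0) (by ring) (by ring)
      (by ring) hp (by rw [gauge_zero, h])
  · exact E.hasElementarySolution_of_polyOp_gauge ha hb hc hp h

/-- Both exponents are `0`, so `v(t) u - u(t) v` vanishes at `t`, hence identically, against
independence. -/
theorem not_isApparent_one (hε : E.ε = 1) : ¬ E.IsApparent 1 := by
  rintro ⟨r, hr, u, v, hu, hv, hu0, hv0, su, sv, hind⟩
  have hmem := Metric.ball_mem_nhds E.t hr
  have hUo : IsOpen (Metric.ball E.t r \ {E.t}) := Metric.isOpen_ball.sdiff isClosed_singleton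
  have hUn : Metric.ball E.t r \ {E.t} ∈ 𝓝[≠] E.t :=
    inter_mem (nhdsWithin_le_nhds hmem) self_mem_nhdsWithin
  simp only [sub_self, zpow_zero, one_mul] at sv hind
  have hw := (hu.const_mul (v E.t)).add (hv.const_mul (-u E.t))
  have hs := IsSolutionOn.linComb E hUo su sv (v E.t) (-u E.t)
  have hz := E.eventually_eq_zero_of_eps_eq_one hε (hw.analyticAt hmem)
    (by simp only [Pi.add_apply]; ring)
    (by filter_upwards [hUn] with z hz using (E.isSolutionOn_iff.1 hs).2.2 z hz)
  have := (hw.analyticOnNhd Metric.isOpen_ball).eqOn_zero_of_preconnected_of_eventuallyEq_zero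
    (convex_ball _ _).isPreconnected (Metric.mem_ball_self hr) hz
  exact hv0 (hind _ _ fun z hz => this hz.1).1

theorem hasElementarySolution_of_isApparent {m n : ℤ} (hα : E.α = m) (hε : E.ε = n)
    (happ : E.IsApparent n) : E.HasElementarySolution := by
  rcases lt_trichotomy n 1 with hn | rfl | hn
  · obtain ⟨r, hr, u, v, hu, hv, hu0, hv0, su, sv, hind⟩ := happ
    obtain ⟨N, rfl⟩ := Int.exists_eq_neg_ofNat (Int.lt_add_one_iff.1 hn : n ≤ 0)
    exact E.hasElementarySolution_of_eps_nonpos hα (by simpa using hε) hr hu hu0 su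
  · exact absurd happ (E.not_isApparent_one (by simpa using hε))
  · obtain ⟨r, hr, u, v, hu, hv, hu0, hv0, su, sv, hind⟩ := happ
    obtain ⟨N, hN⟩ := Int.eq_ofNat_of_zero_le (show 0 ≤ n - 2 by omega)
    obtain rfl : n = N + 2 := by omega
    -- This is the other exponent `1 - n` at `t`: dividing by `(z-t)^k` turns the second solution
    -- into `v` and `ε` into `2 - n = -N`, and keeps `α` integral.
    set k : ℤ := 1 - (N + 2) with hk
    have hkε : (k : ℂ) * (k - 1 + E.ε) = 0 := by
      rw [hε, hk]
      push_cast
      ring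
    refine HasElementarySolution.of_gauge E hkε ?_
    have hUo : IsOpen (Metric.ball E.t r \ {E.t}) := Metric.isOpen_ball.sdiff isClosed_singleton
    refine hasElementarySolution_of_eps_nonpos (E.gauge 0 0 k) (N := N) (m := m + k)
      (by simp [gauge, hα]) (by simp only [gauge]; rw [hε, hk]; push_cast; ring) hr hv hv0 ?_
    refine (E.isSolutionOn_gauge_iff (by ring) (by ring) hkε hUo sv.1 (fun z hz => ?_)
      (fun z hz => zpow_ne_zero k (sub_ne_zero.2 hz.2)) (hv.mono Set.sdiff_subset)).1 sv
    have ht := sub_ne_zero.2 (Set.mem_compl_singleton_iff.1 hz.2)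
    have := (hasDerivAt_zpow k (z - E.t) (Or.inl ht)).comp z ((hasDerivAt_id z).sub_const E.t)
    refine this.congr_deriv ?_
    rw [zpow_sub_one₀ ht, logDer]
    ring

end HeunEquation

end Apparent

/-! ### Continuation of jets and the invariant line. -/

section Reducibility

namespace HeunEquation

variable (E : HeunEquation)

/-- The radius of a disc about `c` on which all local solutions at `c` are defined. -/
noncomputable def radius (c : E.domain) : ℝ := (E.exists_local_solution c.2).choose

theorem radius_pos (c : E.domain) : 0 < E.radius c :=
  (E.exists_local_solution c.2).choose_spec.1

theorem ball_radius_subset (c : E.domain) : Metric.ball (c : ℂ) (E.radius c) ⊆ E.domain :=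
  (E.exists_local_solution c.2).choose_spec.2.1

/-- The local solution at `c` with 1-jet `v`. -/
noncomputable def localSolution (c : E.domain) (v : ℂ × ℂ) : ℂ → ℂ :=
  ((E.exists_local_solution c.2).choose_spec.2.2 v).choose

theorem isSolutionOn_localSolution (c : E.domain) (v : ℂ × ℂ) :
    E.IsSolutionOn (Metric.ball (c : ℂ) (E.radius c)) (E.localSolution c v) :=
  ((E.exists_local_solution c.2).choose_spec.2.2 v).choose_spec.1

theorem jet_localSolution (c : E.domain) (v : ℂ × ℂ) : jet (E.localSolution c v) c = v :=
  ((E.exists_local_solution c.2).choose_spec.2.2 v).choose_spec.2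

/-- The 1-jet at `z` of the local solution at `c` with 1-jet `v`. -/
noncomputable def jetMap (c : E.domain) (z : ℂ) (hz : z ∈ Metric.ball (c : ℂ) (E.radius c)) :
    (ℂ × ℂ) →ₗ[ℂ] (ℂ × ℂ) :=
  have key : ∀ (a b : ℂ) (v w : ℂ × ℂ), jet (E.localSolution c (a • v + b • w)) z =
      a • jet (E.localSolution c v) z + b • jet (E.localSolution c w) z := by
    intro a b v w
    have hv := E.isSolutionOn_localSolution c v
    have hw := E.isSolutionOn_localSolution c w
    have hc := Metric.mem_ball_self (x := (c : ℂ)) (E.radius_pos c)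
    rw [← jet_linComb Metric.isOpen_ball hv.2.1 hw.2.1 a b hz]
    refine jet_congr Metric.isOpen_ball (E.eqOn_of_jet_eq Metric.isOpen_ball
      (convex_ball _ _).isPreconnected hc (E.isSolutionOn_localSolution c _)
      (IsSolutionOn.linComb E Metric.isOpen_ball hv hw a b) ?_) hz
    rw [jet_linComb Metric.isOpen_ball hv.2.1 hw.2.1 a b hc]
    simp only [jet_localSolution]
  { toFun := fun v => jet (E.localSolution c v) z
    map_add' := fun v w => by simpa using key 1 1 v w
    map_smul' := fun a v => by simpa using key a 0 v 0 }

theorem jetMap_injective (c : E.domain) (z : ℂ) (hz : z ∈ Metric.ball (c : ℂ) (E.radius c)) :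
    Function.Injective (E.jetMap c z hz) := by
  intro v w h
  have := jet_congr Metric.isOpen_ball (E.eqOn_of_jet_eq Metric.isOpen_ball
    (convex_ball _ _).isPreconnected hz (E.isSolutionOn_localSolution c v)
    (E.isSolutionOn_localSolution c w) h) (Metric.mem_ball_self (E.radius_pos c))
  simpa only [jet_localSolution] using this

/-- Local continuation of 1-jets of solutions. -/
noncomputable def localTransport : LocalTransport E.domain (ℂ × ℂ) where
  U c := {z | (z : ℂ) ∈ Metric.ball (c : ℂ) (E.radius c)}
  isOpen_U c := Metric.isOpen_ball.preimage continuous_subtype_val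
  mem_U c := Metric.mem_ball_self (E.radius_pos c)
  D c z v := jet (E.localSolution c v) z
  D_self c v := E.jet_localSolution c v
  bijective c z hz :=
    ⟨E.jetMap_injective c z hz, LinearMap.injective_iff_surjective.1 (E.jetMap_injective c z hz)⟩
  agree c c' v v' z hz h z' hz' := by
    have ho : IsOpen (Metric.ball (c : ℂ) (E.radius c) ∩ Metric.ball (c' : ℂ) (E.radius c')) :=
      Metric.isOpen_ball.inter Metric.isOpen_ball
    exact jet_congr ho (E.eqOn_of_jet_eq ho
      ((convex_ball _ _).inter (convex_ball _ _)).isPreconnected hz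
      ((E.isSolutionOn_localSolution c v).mono E Set.inter_subset_left)
      ((E.isSolutionOn_localSolution c' v').mono E Set.inter_subset_right) h) hz'

/-- Transport of 1-jets of solutions along classes of paths. -/
theorem exists_jet_transport :
    ∃ T : ∀ {x y : E.domain}, Path.Homotopic.Quotient x y → (ℂ × ℂ) →ₗ[ℂ] (ℂ × ℂ),
    (∀ x v, T (Path.Homotopic.Quotient.mk (Path.refl x)) v = v) ∧
    (∀ {x y z : E.domain} (g : Path.Homotopic.Quotient x y) (h : Path.Homotopic.Quotient y z) v,
      T (g.trans h) v = T h (T g v)) ∧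
    (∀ {c z : E.domain} (s : Path c z), (∀ τ, (s τ : ℂ) ∈ Metric.ball (c : ℂ) (E.radius c)) →
      ∀ v, T (Path.Homotopic.Quotient.mk s) v = jet (E.localSolution c v) z) := by
  obtain ⟨T, T1, T2, T3⟩ := E.localTransport.exists_transport
  have hz : ∀ {c z : E.domain} (s : Path c z),
      (∀ τ, (s τ : ℂ) ∈ Metric.ball (c : ℂ) (E.radius c)) →
      (z : ℂ) ∈ Metric.ball (c : ℂ) (E.radius c) := fun s hs => by simpa using hs 1
  have hT3 : ∀ {c z : E.domain} (s : Path c z)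
      (hs : ∀ τ, (s τ : ℂ) ∈ Metric.ball (c : ℂ) (E.radius c)) (v),
      T (Path.Homotopic.Quotient.mk s) v = E.jetMap c z (hz s hs) v := fun s hs v => T3 s hs v
  have hU : ∀ c, E.localTransport.U c ∈ 𝓝 c := fun c =>
    (E.localTransport.isOpen_U c).mem_nhds (E.localTransport.mem_U c)
  have hadd : ∀ {x y : E.domain} (g : Path.Homotopic.Quotient x y) (v w : ℂ × ℂ),
      T g (v + w) = T g v + T g w := by
    intro x y g v w
    refine Path.Homotopic.Quotient.induction_short hU
      (fun z g => T g (v + w) = T g v + T g w) ?_ ?_ g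
    · simp only [T1]
    · intro c g z s hs
      simp only [T2, hT3 s hs, ← map_add]
      -- Injectivity supplies the backward direction of the equivalence.
      exact (E.jetMap_injective _ _ _).eq_iff.symm
  have hsmul : ∀ {x y : E.domain} (g : Path.Homotopic.Quotient x y) (a : ℂ) (v : ℂ × ℂ),
      T g (a • v) = a • T g v := by
    intro x y g a v
    refine Path.Homotopic.Quotient.induction_short hU
      (fun z g => T g (a • v) = a • T g v) ?_ ?_ g
    · simp only [T1]
    · intro c g z s hs
      simp only [T2, hT3 s hs, ← map_smul]
      exact (E.jetMap_injective _ _ _).eq_iff.symm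
  exact ⟨fun g => { toFun := T g, map_add' := hadd g, map_smul' := hsmul g }, T1, T2,
    fun s hs v => T3 s hs v⟩

/-- An elementary solution gives, at every point, a line of 1-jets which is compatible with
continuation. -/
theorem HasElementarySolution.exists_line (h : E.HasElementarySolution) :
    ∃ l : E.domain → ℂ × ℂ, (∀ x, l x ≠ 0) ∧ ∀ (c : E.domain) (y : ℂ → ℂ),
      E.IsSolutionOn (Metric.ball (c : ℂ) (E.radius c)) y → ∀ z w : E.domain,
      (z : ℂ) ∈ Metric.ball (c : ℂ) (E.radius c) → (w : ℂ) ∈ Metric.ball (c : ℂ) (E.radius c) →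
      (∃ k : ℂ, jet y z = k • l z) → ∃ k : ℂ, jet y w = k • l w := by
  obtain ⟨a, b, c, p, hp, H⟩ := h
  -- This is the jet of `φ p` divided by `φ`, so it is independent of the branch.
  let l : E.domain → ℂ × ℂ := fun z =>
    (p.eval (z : ℂ), E.logDer a b c z * p.eval (z : ℂ) + (derivative p).eval (z : ℂ))
  have hφ : ∀ x : E.domain, ∃ φ : ℂ → ℂ, ∀ z ∈ Metric.ball (x : ℂ) (E.radius x),
      HasDerivAt φ (E.logDer a b c z * φ z) z ∧ φ z ≠ 0 := fun x =>
    exists_exp_primitive fun z hz => (E.hasDerivAt_logDer a b c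
      (E.ball_radius_subset x hz)).differentiableAt.differentiableWithinAt
  have hjet : ∀ (φ : ℂ → ℂ) (z : E.domain), HasDerivAt φ (E.logDer a b c z * φ z) z →
      jet (fun z => φ z * p.eval z) z = φ z • l z := by
    intro φ z hz
    refine Prod.ext rfl ((hz.mul p.differentiableAt.hasDerivAt).deriv.trans ?_)
    simp only [p.deriv, l, Prod.smul_snd, smul_eq_mul]
    ring
  refine ⟨l, fun x hx => hp ?_, fun x y hy z w hz hw ⟨k, hk⟩ => ?_⟩
  · obtain ⟨φ, hφ⟩ := hφ x
    have hx' := Metric.mem_ball_self (x := (x : ℂ)) (E.radius_pos x)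
    have hs := H _ Metric.isOpen_ball (E.ball_radius_subset x) φ (fun z hz => (hφ z hz).1)
      (fun z hz => (hφ z hz).2)
    have hj := hjet φ x (hφ x hx').1
    rw [hx, smul_zero] at hj
    have h0 := E.eq_zero_of_jet_eq_zero Metric.isOpen_ball (convex_ball _ _).isPreconnected hx' hs
      (congrArg Prod.fst hj) (congrArg Prod.snd hj)
    refine eq_zero_of_infinite_isRoot p ((infinite_of_mem_nhds (x : ℂ)
      (Metric.ball_mem_nhds _ (E.radius_pos x))).mono fun z hz => ?_)
    exact (mul_eq_zero.1 (h0 z hz)).resolve_left (hφ z hz).2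
  · obtain ⟨φ, hφ⟩ := hφ x
    have hs := H _ Metric.isOpen_ball (E.ball_radius_subset x) φ (fun z hz => (hφ z hz).1)
      (fun z hz => (hφ z hz).2)
    -- With this scaling `κ φ p` has the same jet as `y` at `z`, so the two agree on the disc.
    set κ := k / φ z
    have hs' := IsSolutionOn.linComb E Metric.isOpen_ball hs hs κ 0
    have hj : ∀ z : E.domain, (z : ℂ) ∈ Metric.ball (x : ℂ) (E.radius x) →
        jet (fun z => κ * (φ z * p.eval z) + 0 * (φ z * p.eval z)) z = (κ * φ z) • l z := by
      intro z hz
      rw [jet_linComb Metric.isOpen_ball hs.2.1 hs.2.1 κ 0 hz, hjet φ z (hφ z hz).1, zero_smul,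
        add_zero, smul_smul]
    refine ⟨κ * φ w, ?_⟩
    rw [← hj w hw]
    refine jet_congr Metric.isOpen_ball (E.eqOn_of_jet_eq Metric.isOpen_ball
      (convex_ball _ _).isPreconnected hz hy hs' ?_) hw
    rw [hj z hz, hk, div_mul_cancel₀ _ (hφ z hz).2]

/-- `F v` continues the jet `v` from `b`. Transport around a loop rescales `l b`, so `F (l b)` spans
an invariant line; injectivity of `F` on `ℂ × ℂ` makes it nonzero and proper. -/
theorem isMonodromyReducible_of_hasElementarySolution (h : E.HasElementarySolution)
    (b : E.domain) : E.IsMonodromyReducible b := by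
  obtain ⟨T, T1, T2, T3⟩ := E.exists_jet_transport
  obtain ⟨l, hl0, hl⟩ := h.exists_line
  let F : ℂ × ℂ → E.solutions b := fun v => ⟨fun p => (T p.2 v).1, fun x g =>
    ⟨E.radius x, E.radius_pos x, E.localSolution x (T g v), E.isSolutionOn_localSolution x _,
      fun z s hs => by simp only [T2, T3 s hs, jet]⟩⟩
  have hFsmul : ∀ (k : ℂ) v, F (k • v) = k • F v := fun k v =>
    Subtype.ext (funext fun p => by simp [F])
  have hFinj : Function.Injective F := by
    intro v w hvw
    have hb := Metric.mem_ball_self (x := (b : ℂ)) (E.radius_pos b)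
    have heq : Set.EqOn (E.localSolution b v) (E.localSolution b w)
        (Metric.ball (b : ℂ) (E.radius b)) := by
      intro z hz
      obtain ⟨γ, hγ⟩ := ((convex_ball (b : ℂ) (E.radius b)).isPathConnected ⟨b, hb⟩).joinedIn
        b hb z hz
      let s : Path b ⟨z, E.ball_radius_subset b hz⟩ :=
        { toFun := fun τ => ⟨γ τ, E.ball_radius_subset b (hγ τ)⟩
          continuous_toFun := by fun_prop
          source' := Subtype.ext γ.source
          target' := Subtype.ext γ.target }
      have := congrFun (congrArg Subtype.val hvw) ⟨_, Path.Homotopic.Quotient.mk s⟩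
      simpa only [F, T3 s hγ, jet] using this
    have := jet_congr Metric.isOpen_ball heq hb
    simpa only [jet_localSolution] using this
  have hline : ∀ {x : E.domain} (g : Path.Homotopic.Quotient b x),
      ∃ k : ℂ, T g (l b) = k • l x := by
    intro x g
    refine Path.Homotopic.Quotient.induction_short (U := E.localTransport.U)
      (fun c => (E.localTransport.isOpen_U c).mem_nhds (E.localTransport.mem_U c))
      (fun z g => ∃ k : ℂ, T g (l b) = k • l z) ⟨1, by rw [T1, one_smul]⟩ ?_ g
    intro c g z s hs
    have hc : (c : ℂ) ∈ Metric.ball (c : ℂ) (E.radius c) := Metric.mem_ball_self (E.radius_pos c)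
    have hz : (z : ℂ) ∈ Metric.ball (c : ℂ) (E.radius c) := by
      have := hs 1
      rwa [s.target] at this
    have hsol := E.isSolutionOn_localSolution c (T g (l b))
    rw [T2, T3 s hs]
    constructor
    · intro hk
      exact hl c _ hsol c z hc hz (by rwa [jet_localSolution])
    · intro hk
      simpa only [jet_localSolution] using hl c _ hsol z c hz hc hk
  refine ⟨⟨Submodule.span ℂ {F (l b)}, fun σ G hG => ?_⟩, fun hbot => ?_, fun htop => ?_⟩
  · obtain ⟨k, rfl⟩ := Submodule.mem_span_singleton.1 hG
    obtain ⟨k', hk'⟩ := hline σ.toPath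
    have hσ : E.monodromy b σ (F (l b)) = k' • F (l b) := by
      rw [← hFsmul, ← hk']
      exact Subtype.ext (funext fun p => congrArg Prod.fst (T2 σ.toPath p.2 (l b)))
    rw [map_smul, hσ]
    exact Submodule.smul_mem _ _ (Submodule.smul_mem _ _ (Submodule.mem_span_singleton_self _))
  · have h1 : Submodule.span ℂ {F (l b)} = ⊥ := congrArg Subrepresentation.toSubmodule hbot
    rw [Submodule.span_singleton_eq_bot] at h1
    have h2 := hFsmul 0 (l b)
    rw [zero_smul, zero_smul, ← h1] at h2
    exact hl0 b (hFinj h2).symm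
  · have h1 : Submodule.span ℂ {F (l b)} = ⊤ := congrArg Subrepresentation.toSubmodule htop
    have h2 : ∀ v : ℂ × ℂ, ∃ k : ℂ, k • l b = v := by
      intro v
      have : F v ∈ Submodule.span ℂ {F (l b)} := by rw [h1]; trivial
      obtain ⟨k, hk⟩ := Submodule.mem_span_singleton.1 this
      exact ⟨k, hFinj (by rw [hFsmul, hk])⟩
    obtain ⟨k₁, e₁⟩ := h2 (1, 0)
    obtain ⟨k₂, e₂⟩ := h2 (0, 1)
    have a₁ : k₁ * (l b).1 = 1 := congrArg Prod.fst e₁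
    have a₂ : k₁ * (l b).2 = 0 := congrArg Prod.snd e₁
    have a₃ : k₂ * (l b).1 = 0 := congrArg Prod.fst e₂
    have a₄ : k₂ * (l b).2 = 1 := congrArg Prod.snd e₂
    exact one_ne_zero (α := ℂ) (by
      linear_combination k₂ * (l b).1 * a₂ - k₂ * (l b).2 * a₁ - a₄)

end HeunEquation

end Reducibility

theorem mainTheorem6 (E : HeunEquation) (m n : ℤ) (hα : E.α = (m : ℂ)) (hε : E.ε = (n : ℂ))
    (happ : E.IsApparent n) (b : E.domain) : E.IsMonodromyReducible b :=
  E.isMonodromyReducible_of_hasElementarySolution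
    (E.hasElementarySolution_of_isApparent hα hε happ) b
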